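/- **Conventions.** Write $[M]=\{0,\dots,M-1\}$. A signed graph $G_s=(V,E,s)$ is a finite simple graph with non-empty vertex set and a signature $s:E\to\{-1,1\}$; it is balanced if $V$ splits into two (possibly empty) classes such that all edges inside a class are positive and all edges between the classes are negative. A balanced (bipartite) component is a connected component whose induced signed subgraph (subgraph) is balanced (bipartite). Let $V\subseteq[2^n]\setminus\{0\}$ and let every vertex have at most $S$ neighbours. An adjacency mapping is a map $\operatorname{adj}:[2^n]\times[S]\to[2^n]$ such that, for $i\in V$, the values $\operatorname{adj}(i,0),\dots,\operatorname{adj}(i,\deg(i)-1)$ list the neighbours of $i$ without repetition, in some order, and $\operatorname{adj}(i,\ell)=0$ for $\ell\ge\deg(i)$, while $\operatorname{adj}(i,\ell)=\ell$ for $i\notin V$. A *sparse access* with parameters $(n,S)$ consists of the oracles $$O_{\rm adj}|i\rangle|\ell\rangle=|\operatorname{adj}(i,\ell)\rangle|\ell\rangle,\qquad O_{\rm sign}|i\rangle|\ell\rangle|z\rangle=|i\rangle|\ell\rangle|z\oplus s(\{i,\operatorname{adj}(i,\ell)\})\rangle ,$$ which are maps on bit strings; here $i$ has $n$ bits, $\ell$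 has $\lceil\log_2 S\rceil$ bits, $s$ is extended by $0$ to pairs that are not edges, and the values $0,1,-1$ are encoded in two bits. For unsigned graphs there is only $O_{\rm adj}$. The access is called *marked* for general $V\subseteq[2^n]\setminus\{0\}$ and *traditional* when $V=\{1,\dots,N\}$. Circuits are Boolean circuits (constants, NAND gates, unbounded fan-out); an oracle circuit may also contain gates that call the oracles. The size is the number of gates, an oracle call counting as one gate. **Proposition.** (a) There are a constant $c$ and a polynomial $q$ such that for all $n$ and all $S\ge 2$ there are oracle circuits $C_{\rm adj},C_{\rm sign}$, depending only on $n$ and $S$, each of size at most $q(n)$ and with at most $c$ oracle calls, with the following property. Let $G_s=(V,E,s)$ be a signed graph with $V\subseteq[2^n]\setminus\{0\}$ whose degrees are at most $S$, and let $(O_{\rm adj},O_{\rm sign})$ be a marked sparse access for $G_s$ with parameters $(n,S)$. Then there is a signed graph $G_s'=(V',E',s')$ with $V'=\{1,\dots,N'\}$ such that 1. $N'\le 2^{n+1}$; 2. every vertex of $G_s'$ has degree at most $S+2$ (which is polynomially bounded in $n$ whenever $S$ is); 3. $G_s$ has a balanced component if and only if $G_s'$ has a balanced component; 4. the pair $(O_{\rm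 adj}',O_{\rm sign}')$ computed by $C_{\rm adj},C_{\rm sign}$ with oracles $O_{\rm adj},O_{\rm sign}$ is a traditional sparse access for $G_s'$ with parameters $(n+1,S+2)$. Moreover, if $O_{\rm adj},O_{\rm sign}$ are computed by oracle-free circuits of sizes $a$ and $b$, then $O_{\rm adj}'$ and $O_{\rm sign}'$ are each computed by an oracle-free circuit of size at most $q(n)+c(a+b)$; in particular, polynomial-size circuits for the marked access give polynomial-size circuits for the traditional access. (b) The same holds for unsigned graphs $G$, $G'$, with $O_{\rm adj}$ only and with "bipartite component" in place of "balanced component". -/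

import Mathlib

namespace SparseAccess

/-! ### Signed graphs, balanced and bipartite components -/

/-- A signed graph on the vertex set `V`: a simple graph together with a signature `E → {-1, 1}`. -/
structure SignedGraph (V : Type) where
  graph : SimpleGraph V
  sign : graph.edgeSet → ℤˣ

namespace SignedGraph

variable {V : Type}

open Classical in
/-- The sign of the pair `{u, v}` as an integer; it is `0` when `{u, v}` is not an edge. -/
noncomputable def sgn (G : SignedGraph V) (u v : V) : ℤ :=
  if h : G.graph.Adj u v then (G.sign ⟨s(u, v), h⟩ : ℤ) else 0

/-- Structural balance: the vertices split into two (possibly empty) classes such that the edges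
inside a class are positive and the edges between the classes are negative. -/
def IsBalanced (G : SignedGraph V) : Prop :=
  ∃ side : V → Bool, ∀ u v, G.graph.Adj u v →
    (side u = side v → G.sgn u v = 1) ∧ (side u ≠ side v → G.sgn u v = -1)

/-- The signed subgraph induced on a set of vertices. -/
def induce (G : SignedGraph V) (T : Set V) : SignedGraph T where
  graph := G.graph.induce T
  sign e := G.sign ⟨e.1.map Subtype.val, by
    obtain ⟨e, he⟩ := e
    induction e using Sym2.ind with
    | _ u v => exact he⟩

/-- Some connected component of the signed graph is balanced. -/
def HasBalancedComponent (G : SignedGraph V) : Prop :=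
  ∃ c : G.graph.ConnectedComponent, (G.induce c.supp).IsBalanced

end SignedGraph

/-- Some connected component of the graph is bipartite. -/
def HasBipartiteComponent {V : Type} (G : SimpleGraph V) : Prop :=
  ∃ c : G.ConnectedComponent, (G.induce c.supp).IsBipartite

/-! ### Boolean circuits with oracle gates -/

/-- Boolean circuits with oracle gates, in topological order. The oracle named `o : ι` acts on a
register whose bits are indexed by `R o`. An element of `Circuit R W out` is a circuit in which the
wires available so far are indexed by `W` and whose output bits are indexed by `out`. A gate reads
arbitrary available wires (fan-out is unrestricted) and adds its output wires to them. -/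
inductive Circuit {ι : Type} (R : ι → Type) : Type → Type → Type 1 where
  /-- No further gates: every output bit is one of the available wires. -/
  | output {W out : Type} (f : out → W) : Circuit R W out
  /-- A constant gate. -/
  | const {W out : Type} (b : Bool) (rest : Circuit R (Option W) out) : Circuit R W out
  /-- A NAND gate. -/
  | nand {W out : Type} (x y : W) (rest : Circuit R (Option W) out) : Circuit R W out
  /-- One call to the oracle `o`. -/
  | call {W out : Type} (o : ι) (args : R o → W) (rest : Circuit R (W ⊕ R o) out) :
      Circuit R W out

namespace Circuit

variable {ι : Type} {R : ι → Type}

/-- The function computed by a circuit, for given oracles `O` and given values of the wires. -/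
def eval (O : ∀ o, (R o → Bool) → (R o → Bool)) {W out : Type} :
    Circuit R W out → (W → Bool) → (out → Bool)
  | output f, v => fun k => v (f k)
  | const b rest, v => rest.eval O (fun w => w.elim b v)
  | nand x y rest, v => rest.eval O (fun w => w.elim (!(v x && v y)) v)
  | call o args rest, v => rest.eval O (Sum.elim v (O o fun k => v (args k)))

/-- The number of gates, an oracle gate counting as one gate. -/
def size {W out : Type} : Circuit R W out → ℕ
  | output _ => 0
  | const _ rest => rest.size + 1
  | nand _ _ rest => rest.size + 1
  | call _ _ rest => rest.size + 1

/-- The number of oracle gates. -/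
def calls {W out : Type} : Circuit R W out → ℕ
  | output _ => 0
  | const _ rest => rest.calls
  | nand _ _ rest => rest.calls
  | call _ _ rest => rest.calls + 1

end Circuit

/-- Ordinary Boolean circuits: there are no oracles. -/
abbrev BoolCircuit (W out : Type) : Type 1 := Circuit (fun o : Empty => (o.elim : Type)) W out

/-- The Boolean function computed by an ordinary circuit. -/
def BoolCircuit.compute {W out : Type} (C : BoolCircuit W out) : (W → Bool) → (out → Bool) :=
  Circuit.eval (fun o : Empty => o.elim) C

/-! ### Registers -/

/-- The register `|i⟩|ℓ⟩`: `n` bits for `i ∈ [2 ^ n]` and `⌈log₂ S⌉` bits for `ℓ ∈ [S]`. -/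
abbrev AdjRegister (n S : ℕ) : Type := Fin n ⊕ Fin (Nat.clog 2 S)

/-- The register `|i⟩|ℓ⟩|z⟩`, where `z` consists of two bits. -/
abbrev SignRegister (n S : ℕ) : Type := AdjRegister n S ⊕ Fin 2

/-- The basis state `|i⟩|ℓ⟩` (little-endian binary expansions). -/
def adjState (n S i l : ℕ) : AdjRegister n S → Bool :=
  Sum.elim (fun b => i.testBit b) (fun b => l.testBit b)

/-- The basis state `|i⟩|ℓ⟩|z⟩`. -/
def signState (n S i l : ℕ) (z : Fin 2 → Bool) : SignRegister n S → Bool :=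
  Sum.elim (adjState n S i l) z

/-- Two-bit two's complement (least significant bit first) of an element of `{-1, 0, 1}`. -/
def signBits (x : ℤ) : Fin 2 → Bool := ![decide (x ≠ 0), decide (x = -1)]

/-- The names of the two oracles of a signed graph. -/
inductive OracleName where
  | adj
  | sign

/-- The registers on which the two oracles of a signed graph act. -/
abbrev signedRegister (n S : ℕ) : OracleName → Type
  | .adj => AdjRegister n S
  | .sign => SignRegister n S

/-- The register on which the single oracle of an unsigned graph acts. -/
abbrev unsignedRegister (n S : ℕ) : Unit → Type := fun _ => AdjRegister n S

/-! ### Sparse access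

Both access models are covered: the marked model allows every set of vertices
`V ⊆ [2 ^ n] \ {0}`, and the traditional model is the case `V = {1, …, N}`. -/

/-- `adj : [2 ^ n] × [S] → [2 ^ n]` is an adjacency mapping of the graph `G`, whose vertices are
elements of `[2 ^ n] \ {0}` and have at most `S` neighbours. The order in which the neighbours of a
vertex are listed is arbitrary. -/
structure IsAdjMap (n S : ℕ) {V : Finset ℕ} (G : SimpleGraph V) (adj : ℕ → ℕ → ℕ) : Prop where
  verts : V ⊆ Finset.Ico 1 (2 ^ n)
  degree_le : ∀ v : V, (G.neighborSet v).ncard ≤ S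
  lt : ∀ i < 2 ^ n, ∀ l < S, adj i l < 2 ^ n
  neighbor : ∀ v : V, Set.BijOn (adj v) (Set.Iio (G.neighborSet v).ncard)
    (Subtype.val '' G.neighborSet v)
  pad : ∀ v : V, ∀ l < S, (G.neighborSet v).ncard ≤ l → adj v l = 0
  marked : ∀ i < 2 ^ n, i ∉ V → ∀ l < S, adj i l = l

/-- `O |i⟩|ℓ⟩ = |adj(i, ℓ)⟩|ℓ⟩`. -/
def ImplementsAdj (n S : ℕ) (adj : ℕ → ℕ → ℕ)
    (O : (AdjRegister n S → Bool) → (AdjRegister n S → Bool)) : Prop :=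
  ∀ i < 2 ^ n, ∀ l < S, O (adjState n S i l) = adjState n S (adj i l) l

/-- The signature of `G` extended by `0` to all pairs of numbers that are not edges of `G`. -/
noncomputable def natSign {V : Finset ℕ} (G : SignedGraph V) (i j : ℕ) : ℤ :=
  if h : i ∈ V ∧ j ∈ V then G.sgn ⟨i, h.1⟩ ⟨j, h.2⟩ else 0

/-- `O |i⟩|ℓ⟩|z⟩ = |i⟩|ℓ⟩|z ⊕ s({i, adj(i, ℓ)})⟩`. -/
def ImplementsSign (n S : ℕ) {V : Finset ℕ} (G : SignedGraph V) (adj : ℕ → ℕ → ℕ)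
    (O : (SignRegister n S → Bool) → (SignRegister n S → Bool)) : Prop :=
  ∀ i < 2 ^ n, ∀ l < S, ∀ z : Fin 2 → Bool, O (signState n S i l z) =
    signState n S i l (fun b => xor (z b) (signBits (natSign G i (adj i l)) b))

/-- The oracle `O` is a sparse access for the unsigned graph `G`. -/
def IsSparseAccess (n S : ℕ) {V : Finset ℕ} (G : SimpleGraph V)
    (O : ∀ o, (unsignedRegister n S o → Bool) → (unsignedRegister n S o → Bool)) : Prop :=
  ∃ adj, IsAdjMap n S G adj ∧ ImplementsAdj n S adj (O ())

/-- The pair of oracles `O` is a sparse access for the signed graph `G`. -/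
def IsSignedSparseAccess (n S : ℕ) {V : Finset ℕ} (G : SignedGraph V)
    (O : ∀ o, (signedRegister n S o → Bool) → (signedRegister n S o → Bool)) : Prop :=
  ∃ adj, IsAdjMap n S G.graph adj ∧ ImplementsAdj n S adj (O .adj) ∧
    ImplementsSign n S G adj (O .sign)

end SparseAccess

/-! The vertex set is filled up to all of `{1, …, 2 ^ (n + 1) - 1}`, so that vertices no longer need
marking. The new vertices must not create a balanced component, and every new edge must be
computable locally.

On the upper half `[2 ^ n, 2 ^ (n + 1))` two numbers are joined when they differ and their XOR is at
most 3. For `n ≥ 2` this cuts the upper half into copies of `K₄`, and the neighbours of `x` are `x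
^^^ 1`, `x ^^^ 2`, `x ^^^ 3`. Each unused label `i ≠ 0` of the lower half is hung on `i + 2 ^ n` by
a pendant edge. All new edges are negative, and a triangle of negative edges cannot be balanced, so
every component outside `V` is unbalanced. No new edge meets `V`, so the components of `G` survive
unchanged (`padSigned_hasBalancedComponent_iff`). New degrees are at most 4, hence at most `S + 2`.
For `n = 1` there is no room for `K₄`, but then `G` is a single vertex, which is already balanced;
the clique edges are dropped (`cliqueParam`).

Membership in `V` is decided by two queries (`PadWires.mem_iff`): an unused label answers 0, 1 at
the indices 0, 1, and a vertex never does. A third call fetches the original neighbour or sign; the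
rest is a case distinction with `O(n)` gates per output bit (`exists_adjCircuit`,
`exists_signCircuit`). Substituting circuits for the three oracle gates gives the explicit size
bound.

The unsigned case is the signed one with all signs negative: balance becomes bipartiteness
(`hasBalancedComponent_negative_iff`), and padding preserves negativity (`padSigned_negative`). -/

namespace SparseAccess

/-! ### Composition of circuits and substitution for oracle gates -/

namespace Circuit

variable {ι : Type} {R : ι → Type}

/-- Reindex the available wires. -/
def rename : {W out : Type} → Circuit R W out → {W' : Type} → (W → W') → Circuit R W' out
  | _, _, output f, _, g => output (g ∘ f)
  | _, _, const b rest, _, g => const b (rest.rename (Option.map g))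
  | _, _, nand x y rest, _, g => nand (g x) (g y) (rest.rename (Option.map g))
  | _, _, call o args rest, _, g => call o (g ∘ args) (rest.rename (Sum.map g id))

theorem eval_rename (O : ∀ o, (R o → Bool) → (R o → Bool)) {W out : Type}
    (C : Circuit R W out) : ∀ {W' : Type} (g : W → W') (v : W' → Bool),
    (C.rename g).eval O v = C.eval O (v ∘ g) := by
  induction C with
  | output f => intros; rfl
  | const b rest ih =>
    intro W' g v
    simp only [rename, eval, ih]
    congr 1; funext w; cases w <;> rfl
  | nand x y rest ih =>
    intro W' g v
    simp only [rename, eval, ih]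
    congr 1; funext w; cases w <;> rfl
  | call o args rest ih =>
    intro W' g v
    simp only [rename, eval, ih]
    congr 1; funext w; cases w <;> rfl

theorem size_rename {W out : Type} (C : Circuit R W out) :
    ∀ {W' : Type} (g : W → W'), (C.rename g).size = C.size := by
  induction C <;> intros <;> simp_all [rename, size]

theorem calls_rename {W out : Type} (C : Circuit R W out) :
    ∀ {W' : Type} (g : W → W'), (C.rename g).calls = C.calls := by
  induction C <;> intros <;> simp_all [rename, calls]

/-- Run `C`, then `K` on the results of `C` and on the wires selected by `g`. -/
def andThen : {W M : Type} → Circuit R W M → {W₀ out : Type} → Circuit R (W₀ ⊕ M) out →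
    (W₀ → W) → Circuit R W out
  | _, _, output f, _, _, K, g => K.rename (Sum.elim g f)
  | _, _, const b rest, _, _, K, g => const b (rest.andThen K (some ∘ g))
  | _, _, nand x y rest, _, _, K, g => nand x y (rest.andThen K (some ∘ g))
  | _, _, call o args rest, _, _, K, g => call o args (rest.andThen K (Sum.inl ∘ g))

theorem eval_andThen (O : ∀ o, (R o → Bool) → (R o → Bool)) {W M : Type} (C : Circuit R W M) :
    ∀ {W₀ out : Type} (K : Circuit R (W₀ ⊕ M) out) (g : W₀ → W) (v : W → Bool),
    (C.andThen K g).eval O v = K.eval O (Sum.elim (v ∘ g) (C.eval O v)) := by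
  induction C with
  | output f =>
    intro W₀ out K g v
    simp only [andThen, eval_rename, eval]
    congr 1; funext w; cases w <;> rfl
  | const b rest ih => intros; simp only [andThen, eval, ih]; rfl
  | nand x y rest ih => intros; simp only [andThen, eval, ih]; rfl
  | call o args rest ih => intros; simp only [andThen, eval, ih]; rfl

theorem size_andThen {W M : Type} (C : Circuit R W M) :
    ∀ {W₀ out : Type} (K : Circuit R (W₀ ⊕ M) out) (g : W₀ → W),
    (C.andThen K g).size = C.size + K.size := by
  induction C <;> intros <;> simp_all only [andThen, size, size_rename] <;> omega

theorem calls_andThen {W M : Type} (C : Circuit R W M) :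
    ∀ {W₀ out : Type} (K : Circuit R (W₀ ⊕ M) out) (g : W₀ → W),
    (C.andThen K g).calls = C.calls + K.calls := by
  induction C <;> intros <;> simp_all only [andThen, calls, calls_rename] <;> omega

/-- Replace the oracle gates by circuits. -/
def subst {ι' : Type} {R' : ι' → Type} (D : ∀ o, Circuit R' (R o) (R o)) :
    {W out : Type} → Circuit R W out → Circuit R' W out
  | _, _, output f => output f
  | _, _, const b rest => const b (rest.subst D)
  | _, _, nand x y rest => nand x y (rest.subst D)
  | _, _, call o args rest => ((D o).rename args).andThen (rest.subst D) id

theorem eval_subst {ι' : Type} {R' : ι' → Type} (D : ∀ o, Circuit R' (R o) (R o))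
    (O : ∀ o, (R' o → Bool) → (R' o → Bool)) {W out : Type} (C : Circuit R W out) :
    ∀ v, (C.subst D).eval O v = C.eval (fun o => (D o).eval O) v := by
  induction C with
  | output f => intros; rfl
  | const b rest ih => intros; simp only [subst, eval, ih]
  | nand x y rest ih => intros; simp only [subst, eval, ih]
  | call o args rest ih => intros; simp only [subst, eval, eval_andThen, eval_rename, ih]; rfl

/-- The replaced oracle gates are still counted in `C.size`, so the bound is generous by one gate
per call. It is the source of the form `q(n) + c(a + b)`. -/
theorem size_subst_le {ι' : Type} {R' : ι' → Type} (D : ∀ o, Circuit R' (R o) (R o)) {s : ℕ}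
    (hs : ∀ o, (D o).size ≤ s) {W out : Type} (C : Circuit R W out) :
    (C.subst D).size ≤ C.size + C.calls * s := by
  induction C with
  | output f => simp [subst, size]
  | const b rest ih => simp only [subst, size, calls]; omega
  | nand x y rest ih => simp only [subst, size, calls]; omega
  | call o args rest ih =>
    have := hs o
    simp only [subst, size, calls, size_andThen, size_rename, add_mul]; omega

theorem calls_subst_le {ι' : Type} {R' : ι' → Type} (D : ∀ o, Circuit R' (R o) (R o)) {k : ℕ}
    (hk : ∀ o, (D o).calls ≤ k) {W out : Type} (C : Circuit R W out) :
    (C.subst D).calls ≤ C.calls * k := by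
  induction C with
  | output f => simp [subst, calls]
  | const b rest ih => simpa only [subst, calls] using ih
  | nand x y rest ih => simpa only [subst, calls] using ih
  | call o args rest ih =>
    have := hk o
    simp only [subst, calls, calls_andThen, calls_rename, add_mul]; omega

end Circuit

/-! ### Size calculus for oracle-free Boolean functions -/

/-- The Boolean function `f` of the wires is computed by a circuit without oracle gates with at most
`m` gates. -/
def BitSize {ι : Type} (R : ι → Type) {W : Type} (m : ℕ) (f : (W → Bool) → Bool) : Prop :=
  ∃ C : Circuit R W Unit, C.calls = 0 ∧ C.size ≤ m ∧ ∀ O v, C.eval O v () = f v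

namespace BitSize

open Circuit

variable {ι : Type} {R : ι → Type} {W : Type} {m m₁ m₂ m₃ : ℕ}

theorem mono {f : (W → Bool) → Bool} (h : BitSize R m₁ f) (hm : m₁ ≤ m₂) : BitSize R m₂ f := by
  obtain ⟨C, h₁, h₂, h₃⟩ := h
  exact ⟨C, h₁, h₂.trans hm, h₃⟩

theorem wire (w : W) : BitSize R 0 (fun v : W → Bool => v w) :=
  ⟨.output fun _ => w, rfl, le_rfl, fun _ _ => rfl⟩

theorem const (b : Bool) : BitSize R 1 (fun _ : W → Bool => b) :=
  ⟨.const b (.output fun _ => none), rfl, le_rfl, fun _ _ => rfl⟩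

/-- The two circuits run one after the other on the original wires, and one more gate joins their
outputs. Every other connective is derived from this one without sharing, so a subfunction used
twice is paid for twice. -/
theorem nand {f g : (W → Bool) → Bool} (hf : BitSize R m₁ f) (hg : BitSize R m₂ g) :
    BitSize R (m₁ + m₂ + 1) (fun v => !(f v && g v)) := by
  obtain ⟨C, c₁, c₂, c₃⟩ := hf
  obtain ⟨D, d₁, d₂, d₃⟩ := hg
  refine ⟨C.andThen ((D.rename (W' := W ⊕ Unit) Sum.inl).andThen
    (.nand (Sum.inl (Sum.inr ())) (Sum.inr ()) (.output fun _ => none)) id) id, ?_, ?_, ?_⟩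
  · simp [calls_andThen, calls_rename, calls, c₁, d₁]
  · simp [size_andThen, size_rename, size]; omega
  · intro O v
    simp [eval_andThen, eval_rename, eval, c₃, Function.comp_def, d₃]

theorem not {f : (W → Bool) → Bool} (hf : BitSize R m f) :
    BitSize R (m + 2) (fun v => !f v) := by
  simpa using hf.nand (const true)

theorem and {f g : (W → Bool) → Bool} (hf : BitSize R m₁ f) (hg : BitSize R m₂ g) :
    BitSize R (m₁ + m₂ + 3) (fun v => f v && g v) := by
  simpa only [Bool.not_not] using (hf.nand hg).not

theorem or {f g : (W → Bool) → Bool} (hf : BitSize R m₁ f) (hg : BitSize R m₂ g) :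
    BitSize R (m₁ + m₂ + 5) (fun v => f v || g v) := by
  have := hf.not.nand hg.not
  simp only [Bool.not_and, Bool.not_not] at this
  exact this.mono (by omega)

theorem xor {f g : (W → Bool) → Bool} (hf : BitSize R m₁ f) (hg : BitSize R m₂ g) :
    BitSize R (2 * m₁ + 2 * m₂ + 9) (fun v => Bool.xor (f v) (g v)) := by
  have := (hf.or hg).and (hf.nand hg)
  have e : (fun v => (f v || g v) && !(f v && g v)) = fun v => Bool.xor (f v) (g v) := by
    funext v; cases f v <;> cases g v <;> rfl
  rw [e] at this
  exact this.mono (by omega)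

theorem cond {c f g : (W → Bool) → Bool} (hc : BitSize R m₃ c) (hf : BitSize R m₁ f)
    (hg : BitSize R m₂ g) :
    BitSize R (2 * m₃ + m₁ + m₂ + 13) (fun v => bif c v then f v else g v) := by
  have := (hc.and hf).or (hc.not.and hg)
  have e : (fun v => (c v && f v) || (!c v && g v)) = fun v => bif c v then f v else g v := by
    funext v; cases c v <;> simp
  rw [e] at this
  exact this.mono (by omega)

theorem decide_forall : ∀ {p : ℕ} {f : Fin p → (W → Bool) → Bool} (_ : ∀ k, BitSize R m (f k)),
    BitSize R (p * (m + 3) + 1) (fun v => decide (∀ k, f k v = true))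
  | 0, _, _ => by simpa using const true
  | p + 1, f, hf => by
    have := (decide_forall fun k => hf (Fin.succ k)).and (hf 0)
    have e : (fun v => decide (∀ k : Fin p, f k.succ v = true) && f 0 v) =
        fun v => decide (∀ k, f k v = true) := by
      funext v
      rw [Bool.eq_iff_iff]
      simp [Fin.forall_fin_succ, and_comm]
    rw [e] at this
    exact this.mono (by ring_nf; omega)

/-- The test whether the wires `w` carry the binary expansion of the constant `k`. -/
theorem eqConst {p : ℕ} (w : Fin p → W) (k : ℕ) :
    BitSize R (p * 5 + 1) (fun v => decide (∀ b, v (w b) = k.testBit b)) := by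
  have h (b : Fin p) : BitSize R 2 (fun v : W → Bool => v (w b) == k.testBit b) := by
    cases k.testBit b
    · simpa using (wire (w b)).not
    · simpa using (wire (R := R) (w b)).mono (Nat.zero_le 2)
  simpa using decide_forall h

theorem exists_circuit_fin : ∀ {p : ℕ} {f : Fin p → (W → Bool) → Bool}
    (_ : ∀ k, BitSize R m (f k)), ∃ C : Circuit R W (Fin p), C.calls = 0 ∧ C.size ≤ p * m ∧
      ∀ O v k, C.eval O v k = f k v
  | 0, _, _ => ⟨.output Fin.elim0, rfl, Nat.zero_le _, fun _ _ k => k.elim0⟩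
  | p + 1, f, hf => by
    obtain ⟨C, c₁, c₂, c₃⟩ := exists_circuit_fin fun k : Fin p => hf k.succ
    obtain ⟨D, d₁, d₂, d₃⟩ := hf 0
    refine ⟨C.andThen ((D.rename (W' := W ⊕ Fin p) Sum.inl).andThen
      (.output (Fin.cases (Sum.inr ()) fun k => Sum.inl (Sum.inr k))) id) id, ?_, ?_, ?_⟩
    · simp [calls_andThen, calls_rename, calls, c₁, d₁]
    · simp only [size_andThen, size_rename, size, add_mul]; omega
    · intro O v k
      cases k using Fin.cases <;>
        simp [eval_andThen, eval_rename, eval, c₃, Function.comp_def, d₃]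

/-- A circuit computing several Boolean functions in parallel. -/
theorem exists_circuit {out : Type} [Fintype out] {f : out → (W → Bool) → Bool}
    (hf : ∀ k, BitSize R m (f k)) : ∃ C : Circuit R W out, C.calls = 0 ∧
      C.size ≤ Fintype.card out * m ∧ ∀ O v k, C.eval O v k = f k v := by
  obtain ⟨C, c₁, c₂, c₃⟩ :=
    exists_circuit_fin fun k => hf ((Fintype.equivFin out).symm k)
  refine ⟨C.andThen (.output fun k => Sum.inr (Fintype.equivFin out k)) id, ?_, ?_, ?_⟩
  · simp [calls_andThen, calls, c₁]
  · simpa [size_andThen, size] using c₂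
  · simp [eval_andThen, eval, c₃]

end BitSize

/-! ### Components in terms of reachability -/

namespace SignedGraph

variable {V : Type}

theorem sgn_induce (G : SignedGraph V) (T : Set V) (u v : T) :
    (G.induce T).sgn u v = G.sgn u v := by
  unfold sgn
  by_cases h : G.graph.Adj u v
  · rw [dif_pos h, dif_pos (show (G.induce T).graph.Adj u v from h)]
    rfl
  · rw [dif_neg h, dif_neg (show ¬ (G.induce T).graph.Adj u v from h)]

/-- Replacing the component by a root and the partition by a function on all of `V` (arbitrary off
the component) removes the subtypes, so components of different graphs can be compared. -/
theorem hasBalancedComponent_iff (G : SignedGraph V) :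
    G.HasBalancedComponent ↔ ∃ (r : V) (side : V → Bool), ∀ u w, G.graph.Reachable r u →
      G.graph.Adj u w → (side u = side w → G.sgn u w = 1) ∧ (side u ≠ side w → G.sgn u w = -1) := by
  classical
  constructor
  · rintro ⟨c, side, h⟩
    induction c using SimpleGraph.ConnectedComponent.ind with
    | _ r =>
    refine ⟨r, fun u => if hu : u ∈ (G.graph.connectedComponentMk r).supp then side ⟨u, hu⟩
      else false, fun u w hu huw => ?_⟩
    have hu' : u ∈ (G.graph.connectedComponentMk r).supp := by
      simpa using hu.symm
    have hw' : w ∈ (G.graph.connectedComponentMk r).supp := by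
      simpa using (hu.trans huw.reachable).symm
    have := h ⟨u, hu'⟩ ⟨w, hw'⟩ huw
    rw [sgn_induce] at this
    simpa [hu', hw'] using this
  · rintro ⟨r, side, h⟩
    refine ⟨G.graph.connectedComponentMk r, fun u => side u, fun u w huw => ?_⟩
    rw [sgn_induce]
    exact h u w (SimpleGraph.ConnectedComponent.exact u.2).symm huw

/-- The signed graph with a given symmetric signature. -/
def ofSymm (G : SimpleGraph V) (f : V → V → ℤˣ) (hf : ∀ u v, f u v = f v u) : SignedGraph V where
  graph := G
  sign e := Sym2.lift ⟨f, hf⟩ e.1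

theorem sgn_ofSymm {G : SimpleGraph V} {f : V → V → ℤˣ} {hf : ∀ u v, f u v = f v u} {u v : V}
    (h : G.Adj u v) : (ofSymm G f hf).sgn u v = f u v := by
  unfold sgn
  rw [dif_pos (show (ofSymm G f hf).graph.Adj u v from h)]
  rfl

theorem sgn_of_not_adj {G : SignedGraph V} {u v : V} (h : ¬ G.graph.Adj u v) :
    G.sgn u v = 0 := dif_neg h

theorem sgn_comm (G : SignedGraph V) (u v : V) : G.sgn u v = G.sgn v u := by
  unfold sgn
  by_cases h : G.graph.Adj u v
  · rw [dif_pos h, dif_pos h.symm]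
    congr 3
    exact Sym2.eq_swap
  · rw [dif_neg h, dif_neg fun h' => h h'.symm]

theorem sgn_eq_one_or {G : SignedGraph V} {u v : V} (h : G.graph.Adj u v) :
    G.sgn u v = 1 ∨ G.sgn u v = -1 := by
  unfold sgn
  rw [dif_pos h]
  rcases Int.units_eq_one_or (G.sign ⟨s(u, v), h⟩) with h | h <;> simp [h]

end SignedGraph

/-! ### Bipartiteness as balance of the all-negative signature -/

/-- The signed graph all of whose edges are negative. -/
def negative {V : Type} (G : SimpleGraph V) : SignedGraph V :=
  .ofSymm G (fun _ _ => -1) fun _ _ => rfl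

theorem hasBalancedComponent_negative_iff {V : Type} (G : SimpleGraph V) :
    (negative G).HasBalancedComponent ↔ HasBipartiteComponent G := by
  refine exists_congr fun c => ?_
  change ((negative G).induce (c : G.ConnectedComponent).supp).IsBalanced ↔
    (G.induce (c : G.ConnectedComponent).supp).Colorable 2
  have key (u v : (c : G.ConnectedComponent).supp) (h : G.Adj u v) :
      ((negative G).induce (c : G.ConnectedComponent).supp).sgn u v = -1 := by
    exact (SignedGraph.sgn_induce _ _ u v).trans (SignedGraph.sgn_ofSymm h)
  constructor
  · rintro ⟨side, h⟩
    refine ⟨(SimpleGraph.Coloring.mk side fun {u v} huv heq => ?_ :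
      (G.induce (c : G.ConnectedComponent).supp).Coloring Bool).colorable.some⟩
    have := (h u v huv).1 heq
    rw [key u v huv] at this
    omega
  · rintro ⟨col⟩
    refine ⟨fun u => decide (col u = 0), fun u v huv => ⟨fun heq => ?_, fun _ => key u v huv⟩⟩
    have h := col.valid huv
    exfalso
    rw [decide_eq_decide] at heq
    omega

/-! ### The padded graph -/

section Padding

variable {V : Finset ℕ} (n g : ℕ)

/-- Adjacency in the padded graph: edges of `G`, pendant edges `{i, i + 2 ^ n}` for `i ∉ V`, and
cliques on `{2 ^ n, …, 2 ^ (n + 1) - 1}`. -/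
def PadAdj (G : SimpleGraph V) (i j : ℕ) : Prop :=
  (∃ (hi : i ∈ V) (hj : j ∈ V), G.Adj ⟨i, hi⟩ ⟨j, hj⟩) ∨
  (i ∉ V ∧ 1 ≤ i ∧ i < 2 ^ n ∧ j = i + 2 ^ n) ∨
  (j ∉ V ∧ 1 ≤ j ∧ j < 2 ^ n ∧ i = j + 2 ^ n) ∨
  (2 ^ n ≤ i ∧ 2 ^ n ≤ j ∧ i ≠ j ∧ i ^^^ j ≤ g)

/-- The padded graph. -/
def padGraph (G : SimpleGraph V) : SimpleGraph (Finset.Icc 1 (2 ^ (n + 1) - 1)) where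
  Adj u v := PadAdj n g G u v
  symm := ⟨fun u v h => by
    rcases h with ⟨hi, hj, h⟩ | h | h | ⟨h₁, h₂, h₃, h₄⟩
    · exact Or.inl ⟨hj, hi, h.symm⟩
    · exact Or.inr (Or.inr (Or.inl h))
    · exact Or.inr (Or.inl h)
    · exact Or.inr (Or.inr (Or.inr ⟨h₂, h₁, h₃.symm, by rwa [Nat.xor_comm]⟩))⟩
  loopless := ⟨fun u h => by
    have := Nat.two_pow_pos n
    rcases h with ⟨hi, hj, h⟩ | h | h | h
    · exact G.loopless.irrefl _ h
    · omega
    · omega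
    · exact h.2.2.1 rfl⟩

theorem natSign_comm (G : SignedGraph V) (i j : ℕ) : natSign G i j = natSign G j i := by
  unfold natSign
  by_cases h : i ∈ V ∧ j ∈ V
  · rw [dif_pos h, dif_pos h.symm, SignedGraph.sgn_comm]
  · rw [dif_neg h, dif_neg fun h' => h h'.symm]

/-- The padded signed graph: all new edges are negative. -/
noncomputable def padSigned (G : SignedGraph V) :
    SignedGraph (Finset.Icc 1 (2 ^ (n + 1) - 1)) :=
  .ofSymm (padGraph n g G.graph) (fun u v => if natSign G u v = 1 then 1 else -1)
    fun u v => by rw [natSign_comm]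

variable {n g}

theorem mem_Icc_pad (hV : V ⊆ Finset.Ico 1 (2 ^ n)) {i : ℕ} (hi : i ∈ V) :
    i ∈ Finset.Icc 1 (2 ^ (n + 1) - 1) := by
  have := Finset.mem_Ico.1 (hV hi)
  rw [Finset.mem_Icc, pow_succ]
  omega

theorem padAdj_iff_of_mem (hV : V ⊆ Finset.Ico 1 (2 ^ n)) {G : SimpleGraph V} {i j : ℕ}
    (hi : i ∈ V) : PadAdj n g G i j ↔ ∃ hj : j ∈ V, G.Adj ⟨i, hi⟩ ⟨j, hj⟩ := by
  have := Finset.mem_Ico.1 (hV hi)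
  constructor
  · rintro (⟨_, hj, h⟩ | h | h | h)
    · exact ⟨hj, h⟩
    · exact absurd hi h.1
    · omega
    · omega
  · rintro ⟨hj, h⟩
    exact Or.inl ⟨hi, hj, h⟩

theorem padAdj_iff_of_lt {G : SimpleGraph V} {i j : ℕ}
    (hi : i ∉ V) (h₁ : 1 ≤ i) (h₂ : i < 2 ^ n) : PadAdj n g G i j ↔ j = i + 2 ^ n := by
  constructor
  · rintro (⟨h, _⟩ | h | h | h)
    · exact absurd h hi
    · exact h.2.2.2
    · omega
    · omega
  · rintro h
    exact Or.inr (Or.inl ⟨hi, h₁, h₂, h⟩)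

/-- Adding `2 ^ n` to a smaller number only sets bit `n`, which XOR with `k` does not touch. -/
theorem xor_add_two_pow {r k : ℕ} (hr : r < 2 ^ n) (hk : k < 2 ^ n) :
    (r + 2 ^ n) ^^^ k = (r ^^^ k) + 2 ^ n := by
  have h := Nat.xor_lt_two_pow hr hk
  apply Nat.eq_of_testBit_eq
  intro b
  rw [Nat.testBit_xor, add_comm r, add_comm (r ^^^ k)]
  rcases lt_trichotomy b n with hb | rfl | hb
  · rw [Nat.testBit_two_pow_add_gt hb, Nat.testBit_two_pow_add_gt hb, Nat.testBit_xor]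
  · rw [Nat.testBit_two_pow_add_eq, Nat.testBit_two_pow_add_eq, Nat.testBit_lt_two_pow hr,
      Nat.testBit_lt_two_pow h, Nat.testBit_lt_two_pow hk]; rfl
  · have h2 : 2 * 2 ^ n ≤ 2 ^ b := by
      rw [← pow_succ']; exact Nat.pow_le_pow_right (by norm_num) hb
    rw [Nat.testBit_lt_two_pow (by omega), Nat.testBit_lt_two_pow (by omega),
      Nat.testBit_lt_two_pow (by omega)]; rfl

/-- XOR is an involution, so the clique neighbours of a vertex are its XORs with `1, …, g`; this is
the enumeration the circuits use. The case `r = 0` has no pendant edge because 0 is not a vertex. -/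
theorem padAdj_iff_of_add (hV : V ⊆ Finset.Ico 1 (2 ^ n)) {G : SimpleGraph V} {r j : ℕ}
    (hg : g < 2 ^ n) (hr : r < 2 ^ n) : PadAdj n g G (r + 2 ^ n) j ↔
      (∃ l < g, (r ^^^ (l + 1)) + 2 ^ n = j) ∨ (r ≠ 0 ∧ r ∉ V ∧ j = r) := by
  constructor
  · rintro (⟨h, _⟩ | h | h | ⟨h₁, h₂, h₃, h₄⟩)
    · have := Finset.mem_Ico.1 (hV h); omega
    · omega
    · obtain rfl : j = r := by omega
      exact Or.inr ⟨by omega, h.1, rfl⟩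
    · left
      have h0 : (r + 2 ^ n) ^^^ j ≠ 0 := by simpa [Nat.xor_eq_zero_iff] using h₃
      refine ⟨((r + 2 ^ n) ^^^ j) - 1, by omega, ?_⟩
      rw [Nat.sub_add_cancel (by omega), ← xor_add_two_pow hr (by omega), ← Nat.xor_assoc]
      simp
  · rintro (⟨l, hl, rfl⟩ | ⟨h₁, h₂, rfl⟩)
    · refine Or.inr (Or.inr (Or.inr ⟨by omega, by omega, ?_, ?_⟩))
      · rw [← xor_add_two_pow hr (by omega)]
        intro h
        have h' := congrArg (fun x => (r + 2 ^ n) ^^^ x) h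
        simp at h'
      · rw [← xor_add_two_pow hr (by omega), ← Nat.xor_assoc]
        simpa using hl
    · exact Or.inr (Or.inr (Or.inl ⟨h₂, by omega, hr, rfl⟩))

theorem natSign_of_adj {W : Finset ℕ} (G : SignedGraph W) (i j : W) :
    natSign G i j = G.sgn i j := by
  rw [natSign, dif_pos ⟨i.2, j.2⟩]

theorem mem_of_natSign_ne_zero {G : SignedGraph V} {i j : ℕ} (h : natSign G i j ≠ 0) :
    ∃ (hi : i ∈ V) (hj : j ∈ V), G.graph.Adj ⟨i, hi⟩ ⟨j, hj⟩ := by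
  unfold natSign at h
  split_ifs at h with hij
  · refine ⟨hij.1, hij.2, ?_⟩
    by_contra hadj
    exact h (SignedGraph.sgn_of_not_adj hadj)
  · exact absurd rfl h

theorem natSign_padSigned_of_mem (hV : V ⊆ Finset.Ico 1 (2 ^ n)) (G : SignedGraph V) {i : ℕ}
    (hi : i ∈ V) (j : ℕ) : natSign (padSigned n g G) i j = natSign G i j := by
  by_cases hj : ∃ hj : j ∈ V, G.graph.Adj ⟨i, hi⟩ ⟨j, hj⟩
  · have hp := (padAdj_iff_of_mem (g := g) hV hi).2 hj
    obtain ⟨hj, hadj⟩ := hj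
    have hp' : (padGraph n g G.graph).Adj ⟨i, mem_Icc_pad hV hi⟩ ⟨j, mem_Icc_pad hV hj⟩ := hp
    rw [natSign, dif_pos ⟨mem_Icc_pad hV hi, mem_Icc_pad hV hj⟩, padSigned,
      SignedGraph.sgn_ofSymm hp']
    have := SignedGraph.sgn_eq_one_or hadj
    rw [← natSign_of_adj] at this
    rcases this with h | h <;> simp only at h ⊢ <;> simp [h]
  · trans 0
    · by_contra h
      obtain ⟨_, _, h⟩ := mem_of_natSign_ne_zero h
      exact hj ((padAdj_iff_of_mem hV hi).1 h)
    · by_contra h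
      obtain ⟨_, h₂, h₃⟩ := mem_of_natSign_ne_zero (Ne.symm h)
      exact hj ⟨h₂, h₃⟩

theorem natSign_padSigned_of_not_mem {G : SignedGraph V} {i j : ℕ}
    (hi : i ∉ V) (hi' : i ∈ Finset.Icc 1 (2 ^ (n + 1) - 1))
    (hj' : j ∈ Finset.Icc 1 (2 ^ (n + 1) - 1)) (h : PadAdj n g G.graph i j) :
    natSign (padSigned n g G) i j = -1 := by
  have h' : (padGraph n g G.graph).Adj ⟨i, hi'⟩ ⟨j, hj'⟩ := h
  rw [natSign, dif_pos ⟨hi', hj'⟩, padSigned, SignedGraph.sgn_ofSymm h', if_neg]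
  · rfl
  · intro h
    obtain ⟨h, _⟩ := mem_of_natSign_ne_zero (G := G) (i := i) (j := j) (by simp only at h; omega)
    exact hi h

/-- The forward direction holds for every `g`, since `V` is closed under adjacency. Only the
converse needs the cliques, unless `G` is known to have a balanced component; hence the disjunctive
hypothesis. -/
theorem padSigned_hasBalancedComponent_iff (hV : V ⊆ Finset.Ico 1 (2 ^ n)) (G : SignedGraph V)
    (hg : (g = 3 ∧ 2 ≤ n) ∨ G.HasBalancedComponent) :
    G.HasBalancedComponent ↔ (padSigned n g G).HasBalancedComponent := by
  classical
  have hsgn (u w : V) : (padSigned n g G).sgn ⟨u, mem_Icc_pad hV u.2⟩ ⟨w, mem_Icc_pad hV w.2⟩ =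
      G.sgn u w := by
    rw [← natSign_of_adj, ← natSign_of_adj]
    exact natSign_padSigned_of_mem hV G u.2 w
  constructor
  · rw [SignedGraph.hasBalancedComponent_iff, SignedGraph.hasBalancedComponent_iff]
    rintro ⟨r, side, h⟩
    have reach (u) (hu : (padSigned n g G).graph.Reachable ⟨r, mem_Icc_pad hV r.2⟩ u) :
        ∃ hu : u.1 ∈ V, G.graph.Reachable r ⟨u, hu⟩ := by
      rw [SimpleGraph.reachable_iff_reflTransGen] at hu
      induction hu with
      | refl => exact ⟨r.2, .rfl⟩
      | tail _ hadj ih =>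
        obtain ⟨hb, ih⟩ := ih
        obtain ⟨hc, hadj⟩ := (padAdj_iff_of_mem hV hb).1 hadj
        exact ⟨hc, ih.trans hadj.reachable⟩
    refine ⟨⟨r, mem_Icc_pad hV r.2⟩, fun u => if hu : u.1 ∈ V then side ⟨u, hu⟩ else false,
      fun u w hu huw => ?_⟩
    obtain ⟨huV, hu⟩ := reach u hu
    obtain ⟨hwV, hadj⟩ := (padAdj_iff_of_mem hV huV).1 huw
    have := h _ _ hu hadj
    rw [← hsgn] at this
    simpa [huV, hwV] using this
  · intro h
    rcases hg with ⟨rfl, hn⟩ | hg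
    swap
    · exact hg
    rw [SignedGraph.hasBalancedComponent_iff] at h ⊢
    obtain ⟨⟨r, hr⟩, side, h⟩ := h
    by_cases hrV : r ∈ V
    · refine ⟨⟨r, hrV⟩, fun u => side ⟨u, mem_Icc_pad hV u.2⟩, fun u w hu huw => ?_⟩
      let φ : G.graph →g (padSigned n 3 G).graph :=
        ⟨fun u => ⟨u, mem_Icc_pad hV u.2⟩, fun {u w} h => Or.inl ⟨u.2, w.2, h⟩⟩
      rw [← hsgn]
      exact h _ _ (hu.map φ) (φ.map_adj huw)
    · exfalso
      have h4 : 2 ^ 2 ≤ 2 ^ n := Nat.pow_le_pow_right (by norm_num) hn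
      have h2 : 2 ^ (n + 1) = 2 * 2 ^ n := pow_succ' 2 n
      rw [Finset.mem_Icc] at hr
      -- A root outside `V` lies in the upper half or reaches it along its pendant edge.
      obtain ⟨s, hs, hs', hreach⟩ : ∃ (s : ℕ) (hs : s < 2 ^ n)
          (hs' : s + 2 ^ n ∈ Finset.Icc 1 (2 ^ (n + 1) - 1)),
          (padSigned n 3 G).graph.Reachable ⟨r, Finset.mem_Icc.2 hr⟩ ⟨s + 2 ^ n, hs'⟩ := by
        by_cases hlt : r < 2 ^ n
        · refine ⟨r, hlt, Finset.mem_Icc.2 (by omega), SimpleGraph.Adj.reachable ?_⟩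
          exact (padAdj_iff_of_lt hrV hr.1 hlt).2 rfl
        · refine ⟨r - 2 ^ n, by omega, Finset.mem_Icc.2 (by omega), ?_⟩
          have : r - 2 ^ n + 2 ^ n = r := by omega
          simp only [this]
          exact .rfl
      have hx (k : ℕ) (hk : k < 4) : (s ^^^ k) + 2 ^ n ∈ Finset.Icc 1 (2 ^ (n + 1) - 1) := by
        have := Nat.xor_lt_two_pow hs (show k < 2 ^ n by omega)
        rw [Finset.mem_Icc]; omega
      have hadj (k l : ℕ) (hk : k < 4) (hl : l < 4) (hkl : k ≠ l) :
          (padSigned n 3 G).graph.Adj ⟨_, hx k hk⟩ ⟨_, hx l hl⟩ := by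
        refine Or.inr (Or.inr (Or.inr ⟨Nat.le_add_left _ _, Nat.le_add_left _ _, ?_, ?_⟩))
        · intro h
          exact hkl (Nat.xor_right_injective (Nat.add_right_cancel h))
        · have hk' := Nat.xor_lt_two_pow hs (show k < 2 ^ n by omega)
          have hl' := Nat.xor_lt_two_pow hs (show l < 2 ^ n by omega)
          change ((s ^^^ k) + 2 ^ n) ^^^ ((s ^^^ l) + 2 ^ n) ≤ 3
          rw [← xor_add_two_pow hs (by omega), ← xor_add_two_pow hs (by omega),
            Nat.xor_comm _ k, Nat.xor_assoc, ← Nat.xor_assoc _ _ l]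
          simp only [Nat.xor_self, Nat.zero_xor]
          exact Nat.le_of_lt_succ (Nat.xor_lt_two_pow (n := 2) hk hl)
      have hr0 (k : ℕ) (hk : k < 4) : (padSigned n 3 G).graph.Reachable
          ⟨r, Finset.mem_Icc.2 hr⟩ ⟨_, hx k hk⟩ := by
        refine hreach.trans ?_
        rcases Nat.eq_zero_or_pos k with rfl | hk0
        · simp only [Nat.xor_zero]; exact .rfl
        · have := (hadj 0 k (by omega) hk (by omega)).reachable
          simpa only [Nat.xor_zero] using this
      -- Negative edges force different sides, and three mutually adjacent vertices cannot lie on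
      -- pairwise different sides out of two.
      have hne (k l : ℕ) (hk : k < 4) (hl : l < 4) (hkl : k ≠ l) :
          side ⟨_, hx k hk⟩ ≠ side ⟨_, hx l hl⟩ := by
        intro heq
        have h₁ := (h _ _ (hr0 k hk) (hadj k l hk hl hkl)).1 heq
        rw [← natSign_of_adj, natSign_padSigned_of_not_mem ?_ (hx k hk) (hx l hl)
          (hadj k l hk hl hkl)] at h₁
        · omega
        · intro hmem
          have := Finset.mem_Ico.1 (hV hmem)
          omega
      have h₁ := hne 0 1 (by omega) (by omega) (by omega)
      have h₂ := hne 0 2 (by omega) (by omega) (by omega)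
      have h₃ := hne 1 2 (by omega) (by omega) (by omega)
      revert h₁ h₂ h₃
      generalize side ⟨_, hx 0 (by omega)⟩ = a
      generalize side ⟨_, hx 1 (by omega)⟩ = b
      generalize side ⟨_, hx 2 (by omega)⟩ = c
      revert a b c
      decide

end Padding

/-! ### The adjacency mapping of the padded graph -/

section AdjMap

variable {V : Finset ℕ} {n g S : ℕ} {adj : ℕ → ℕ → ℕ}

/-- An adjacency mapping of the padded graph, in terms of one of the given graph. -/
def padAdjMap (n g S : ℕ) (V : Finset ℕ) (adj : ℕ → ℕ → ℕ) (i l : ℕ) : ℕ :=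
  if i < 2 ^ n then
    if i = 0 then l else if i ∈ V then (if l < S then adj i l else 0)
    else if l = 0 then i + 2 ^ n else 0
  else if l < g then ((i - 2 ^ n) ^^^ (l + 1)) + 2 ^ n
  else if l = g ∧ i - 2 ^ n ≠ 0 ∧ i - 2 ^ n ∉ V then i - 2 ^ n else 0

/-- The signs of the edges listed by `padAdjMap`. -/
noncomputable def padSignMap (n g S : ℕ) (G : SignedGraph V) (adj : ℕ → ℕ → ℕ) (i l : ℕ) : ℤ :=
  if i < 2 ^ n then
    if i = 0 then 0 else if i ∈ V then (if l < S then natSign G i (adj i l) else 0)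
    else if l = 0 then -1 else 0
  else if l < g then -1
  else if l = g ∧ i - 2 ^ n ≠ 0 ∧ i - 2 ^ n ∉ V then -1 else 0

theorem ncard_eq_of_bijOn {s : Set ℕ} {f : ℕ → ℕ} {k : ℕ} (h : Set.BijOn f (Set.Iio k) s) :
    s.ncard = k := by
  rw [← h.image_eq, h.injOn.ncard_image]
  simp [← Finset.coe_Iio]

/-- A bijection from an initial segment determines the degree, so degrees of the padded graph need
never be counted separately. -/
theorem IsAdjMap.of_exists {G : SimpleGraph V} (hV : V ⊆ Finset.Ico 1 (2 ^ n))
    (hlt : ∀ i < 2 ^ n, ∀ l < S, adj i l < 2 ^ n)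
    (hmarked : ∀ i < 2 ^ n, i ∉ V → ∀ l < S, adj i l = l)
    (h : ∀ v : V, ∃ k ≤ S, Set.BijOn (adj v) (Set.Iio k) (Subtype.val '' G.neighborSet v) ∧
      ∀ l < S, k ≤ l → adj v l = 0) : IsAdjMap n S G adj := by
  have key (v : V) : (G.neighborSet v).ncard ≤ S ∧
      Set.BijOn (adj v) (Set.Iio (G.neighborSet v).ncard) (Subtype.val '' G.neighborSet v) ∧
      ∀ l < S, (G.neighborSet v).ncard ≤ l → adj v l = 0 := by
    obtain ⟨k, hk, hbij, hpad⟩ := h v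
    have hc := ncard_eq_of_bijOn hbij
    rw [Set.ncard_image_of_injective _ Subtype.val_injective] at hc
    rw [hc]
    exact ⟨hk, hbij, hpad⟩
  exact ⟨hV, fun v => (key v).1, hlt, fun v => (key v).2.1, fun v => (key v).2.2, hmarked⟩

/-- The label 0 is never a vertex, so its answer at the last index is `S - 1`, which must fit into
`n` bits. -/
theorem IsAdjMap.le_two_pow {G : SimpleGraph V} (h : IsAdjMap n S G adj) (hS : 1 ≤ S) :
    S ≤ 2 ^ n := by
  have h0 : 0 ∉ V := fun h0 => by simpa using h.verts h0
  have h₁ := h.marked 0 (Nat.two_pow_pos n) h0 (S - 1) (by omega)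
  have h₂ := h.lt 0 (Nat.two_pow_pos n) (S - 1) (by omega)
  omega

/-- What needs proof is that no neighbour leaves the range: XOR with a number below `2 ^ (n + 1)`
stays below it. -/
theorem image_neighborSet_padGraph (hV : V ⊆ Finset.Ico 1 (2 ^ n)) {G : SimpleGraph V}
    (hg : g < 2 ^ n) (v : Finset.Icc 1 (2 ^ (n + 1) - 1)) :
    Subtype.val '' (padGraph n g G).neighborSet v = {j | PadAdj n g G v j} := by
  have hv := Finset.mem_Icc.1 v.2
  have h2 : 2 ^ (n + 1) = 2 * 2 ^ n := pow_succ' 2 n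
  ext j
  constructor
  · rintro ⟨w, hw, rfl⟩
    exact hw
  · intro hj
    refine ⟨⟨j, ?_⟩, hj, rfl⟩
    rw [Finset.mem_Icc]
    rcases hj with ⟨_, h, _⟩ | h | h | h
    · have := Finset.mem_Ico.1 (hV h); omega
    · omega
    · omega
    · refine ⟨by omega, ?_⟩
      have hx : (v : ℕ) ^^^ j < 2 ^ (n + 1) := by omega
      have : (v : ℕ) ^^^ ((v : ℕ) ^^^ j) < 2 ^ (n + 1) :=
        Nat.xor_lt_two_pow (by omega) hx
      rw [← Nat.xor_assoc, Nat.xor_self, Nat.zero_xor] at this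
      omega

theorem isAdjMap_pad {G : SimpleGraph V} (h : IsAdjMap n S G adj) (hS : 2 ≤ S) (hg : g < 2 ^ n)
    (hg3 : g ≤ 3) : IsAdjMap (n + 1) (S + 2) (padGraph n g G) (padAdjMap n g S V adj) := by
  have hSn := h.le_two_pow (by omega)
  have h2 : 2 ^ (n + 1) = 2 * 2 ^ n := pow_succ' 2 n
  have hxor (r l : ℕ) (hr : r < 2 ^ n) (hl : l < g) : r ^^^ (l + 1) < 2 ^ n :=
    Nat.xor_lt_two_pow hr (by omega)
  refine .of_exists ?_ ?_ ?_ ?_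
  · intro i hi
    rw [Finset.mem_Icc] at hi
    rw [Finset.mem_Ico]
    omega
  · intro i hi l hl
    unfold padAdjMap
    split_ifs with h₁ h₂ h₃ h₄ h₅ h₆
    · omega
    · have := h.lt i h₁ l h₄; omega
    · omega
    · omega
    · omega
    · have := hxor (i - 2 ^ n) l (by omega) h₆; omega
    · omega
    · omega
  · intro i hi hi' l hl
    rw [Finset.mem_Icc] at hi'
    -- 0 is the only label left that is not a vertex, hence the only one still answering with the
    -- index.
    obtain rfl : i = 0 := by omega
    simp [padAdjMap]
  · intro v
    rw [image_neighborSet_padGraph h.verts hg]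
    obtain ⟨i, hi⟩ := v
    rw [Finset.mem_Icc] at hi
    by_cases hlt : i < 2 ^ n
    · by_cases hiV : i ∈ V
      · refine ⟨(G.neighborSet ⟨i, hiV⟩).ncard, (h.degree_le _).trans (by omega), ?_, ?_⟩
        · have hs : {j | PadAdj n g G i j} = Subtype.val '' G.neighborSet ⟨i, hiV⟩ := by
            ext j
            rw [Set.mem_ofPred_eq, padAdj_iff_of_mem h.verts hiV]
            simp
          rw [hs]
          refine (h.neighbor ⟨i, hiV⟩).congr fun l hl => ?_
          have hl' : l < S := lt_of_lt_of_le hl (h.degree_le _)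
          simp [padAdjMap, hlt, hiV, hl', show i ≠ 0 by omega]
        · intro l hl hk
          by_cases hl' : l < S
          · simpa [padAdjMap, hlt, hiV, hl', show i ≠ 0 by omega] using h.pad ⟨i, hiV⟩ l hl' hk
          · simp [padAdjMap, hlt, hiV, hl', show i ≠ 0 by omega]
      · refine ⟨1, by omega, ?_, ?_⟩
        · have hs : {j | PadAdj n g G i j} = {i + 2 ^ n} := by
            ext j
            rw [Set.mem_ofPred_eq, padAdj_iff_of_lt hiV hi.1 hlt]
            rfl
          have h1 : Set.Iio 1 = ({0} : Set ℕ) := by ext; simp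
          rw [hs, h1, Set.bijOn_singleton]
          simp [padAdjMap, hlt, hiV, show i ≠ 0 by omega]
        · intro l _ hl
          simp [padAdjMap, hlt, hiV, show i ≠ 0 by omega, show l ≠ 0 by omega]
    · obtain ⟨r, rfl⟩ : ∃ r, i = r + 2 ^ n := ⟨i - 2 ^ n, by omega⟩
      have hr : r < 2 ^ n := by omega
      have hs : {j | PadAdj n g G (r + 2 ^ n) j} =
          {j | (∃ l < g, (r ^^^ (l + 1)) + 2 ^ n = j) ∨ (r ≠ 0 ∧ r ∉ V ∧ j = r)} := by
        ext j
        exact padAdj_iff_of_add h.verts hg hr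
      have hval (l : ℕ) : padAdjMap n g S V adj (r + 2 ^ n) l =
          if l < g then (r ^^^ (l + 1)) + 2 ^ n else if l = g ∧ r ≠ 0 ∧ r ∉ V then r else 0 := by
        simp [padAdjMap]
      have hinj : ∀ l l', (r ^^^ (l + 1)) + 2 ^ n = (r ^^^ (l' + 1)) + 2 ^ n → l = l' := by
        intro l l' hll
        have := Nat.xor_right_injective (Nat.add_right_cancel hll)
        omega
      rw [hs]
      by_cases hrV : r ≠ 0 ∧ r ∉ V
      -- There are `g` clique neighbours and one pendant; `g + 1 ≤ 4 ≤ S + 2` uses `2 ≤ S`.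
      · refine ⟨g + 1, by omega, ⟨?_, ?_, ?_⟩, ?_⟩
        · intro l hl
          rw [Set.mem_Iio] at hl
          rw [Set.mem_ofPred_eq, hval]
          by_cases hlg : l < g
          · rw [if_pos hlg]; exact Or.inl ⟨l, hlg, rfl⟩
          · rw [if_neg hlg, if_pos ⟨by omega, hrV⟩]; exact Or.inr ⟨hrV.1, hrV.2, rfl⟩
        · intro l hl l' hl' hll
          rw [Set.mem_Iio] at hl hl'
          simp only [hval] at hll
          -- Clique neighbours are at least `2 ^ n` and the pendant neighbour is below it, so the
          -- two kinds never collide.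
          split_ifs at hll with h₁ h₂ h₃ h₄ h₅ h₆ <;> first | exact hinj _ _ hll | omega
        · rintro j (⟨l, hl, rfl⟩ | ⟨_, _, rfl⟩)
          · exact ⟨l, by rw [Set.mem_Iio]; omega, by rw [hval, if_pos hl]⟩
          · exact ⟨g, by rw [Set.mem_Iio]; omega, by rw [hval, if_neg (by omega), if_pos ⟨rfl, hrV⟩]⟩
        · intro l _ hl
          simp only [hval]
          rw [if_neg (by omega), if_neg (by omega)]
      · refine ⟨g, by omega, ⟨?_, ?_, ?_⟩, ?_⟩
        · intro l hl
          rw [Set.mem_Iio] at hl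
          rw [Set.mem_ofPred_eq, hval, if_pos hl]
          exact Or.inl ⟨l, hl, rfl⟩
        · intro l hl l' hl' hll
          rw [Set.mem_Iio] at hl hl'
          simp only [hval, if_pos hl, if_pos hl'] at hll
          exact hinj _ _ hll
        · rintro j (⟨l, hl, rfl⟩ | ⟨h₁, h₂, _⟩)
          · exact ⟨l, hl, by rw [hval, if_pos hl]⟩
          · exact absurd ⟨h₁, h₂⟩ hrV
        · intro l _ hl
          simp only [hval]
          rw [if_neg (by omega), if_neg fun h => hrV h.2]

theorem natSign_eq_zero_of_not_mem {G : SignedGraph V} {i j : ℕ} (h : i ∉ V ∨ j ∉ V) :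
    natSign G i j = 0 := dif_neg (by tauto)

/-- Padding entries point to 0, which is not a vertex of either graph, so their sign is 0. -/
theorem natSign_padAdjMap {G : SignedGraph V} (h : IsAdjMap n S G.graph adj) (hS : 2 ≤ S)
    (hg : g < 2 ^ n) (hg3 : g ≤ 3) {i l : ℕ} (hi : i < 2 ^ (n + 1)) (hl : l < S + 2) :
    natSign (padSigned n g G) i (padAdjMap n g S V adj i l) = padSignMap n g S G adj i l := by
  have hlt := (isAdjMap_pad h hS hg hg3).lt i hi l hl
  have h2 : 2 ^ (n + 1) = 2 * 2 ^ n := pow_succ' 2 n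
  have h0 : 0 ∉ V := fun h0 => by simpa using h.verts h0
  have h0' : 0 ∉ Finset.Icc 1 (2 ^ (n + 1) - 1) := by simp
  have hpos := Nat.two_pow_pos n
  have hV {r : ℕ} : ¬ r + 2 ^ n ∈ V := fun hr => by
    have := Finset.mem_Ico.1 (h.verts hr); omega
  by_cases hlt' : i < 2 ^ n
  · by_cases hi0 : i = 0
    · subst hi0
      rw [natSign_eq_zero_of_not_mem (Or.inl h0')]
      simp [padSignMap]
    · by_cases hiV : i ∈ V
      · rw [natSign_padSigned_of_mem h.verts G hiV]
        by_cases hlS : l < S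
        · simp [padAdjMap, padSignMap, hlt', hi0, hiV, hlS]
        · simp [padAdjMap, padSignMap, hlt', hi0, hiV, hlS, natSign_eq_zero_of_not_mem, h0]
      · by_cases hl0 : l = 0
        · simp only [padAdjMap, padSignMap, hlt', hi0, hiV, hl0, if_true, if_false] at hlt ⊢
          exact natSign_padSigned_of_not_mem hiV (Finset.mem_Icc.2 (by omega))
            (Finset.mem_Icc.2 (by omega)) ((padAdj_iff_of_lt hiV (by omega) hlt').2 rfl)
        · simp [padAdjMap, padSignMap, hlt', hi0, hiV, hl0, natSign_eq_zero_of_not_mem]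
  · obtain ⟨r, rfl⟩ : ∃ r, i = r + 2 ^ n := ⟨i - 2 ^ n, by omega⟩
    have hr : r < 2 ^ n := by omega
    by_cases hlg : l < g
    · simp only [padAdjMap, padSignMap, hlt', hlg, if_true, if_false, Nat.add_sub_cancel] at hlt ⊢
      exact natSign_padSigned_of_not_mem hV (Finset.mem_Icc.2 (by omega))
        (Finset.mem_Icc.2 (by omega))
        ((padAdj_iff_of_add h.verts hg hr).2 (Or.inl ⟨l, hlg, rfl⟩))
    · by_cases hc : l = g ∧ r ≠ 0 ∧ r ∉ V
      · simp only [padAdjMap, padSignMap, hlt', hlg, if_false, Nat.add_sub_cancel, if_pos hc]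
        exact natSign_padSigned_of_not_mem hV (Finset.mem_Icc.2 (by omega))
          (Finset.mem_Icc.2 (by omega))
          ((padAdj_iff_of_add h.verts hg hr).2 (Or.inr ⟨hc.2.1, hc.2.2, rfl⟩))
      · simp only [padAdjMap, padSignMap, hlt', hlg, if_false, Nat.add_sub_cancel, if_neg hc]
        exact natSign_eq_zero_of_not_mem (Or.inr h0')

end AdjMap

/-! ### The circuits of the padded graph -/

theorem testBit_eq_iff {p x k : ℕ} (hx : x < 2 ^ p) (hk : k < 2 ^ p) :
    (∀ b : Fin p, x.testBit b = k.testBit b) ↔ x = k := by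
  refine ⟨fun h => Nat.eq_of_testBit_eq fun b => ?_, fun h _ => by rw [h]⟩
  by_cases hb : b < p
  · exact h ⟨b, hb⟩
  · have := Nat.pow_le_pow_right (show 0 < 2 by norm_num) (not_lt.1 hb)
    rw [Nat.testBit_lt_two_pow (by omega), Nat.testBit_lt_two_pow (by omega)]

/-- The wires read by the circuits of the padded graph: the top bit and the lower bits of the vertex,
the bits of the index, and the answers of the oracle for the indices `0` and `1`. -/
structure PadWires (n S : ℕ) (W : Type) where
  hi : W
  low : Fin n → W
  idx : Fin (Nat.clog 2 (S + 2)) → W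
  ans₀ : Fin n → W
  ans₁ : Fin n → W

namespace PadWires

variable {n S : ℕ} {W : Type} (w : PadWires n S W) (g : ℕ) (v : W → Bool)

/-- The index is `k`. -/
def idxEq (k : ℕ) : Bool := decide (∀ b, v (w.idx b) = k.testBit b)

/-- The lower part of the vertex is `0`. -/
def isZero : Bool := decide (∀ b, v (w.low b) = Nat.testBit 0 b)

/-- The lower part of the vertex is a vertex of the original graph. -/
def isVertex : Bool :=
  !(decide (∀ b, v (w.ans₀ b) = Nat.testBit 0 b) && decide (∀ b, v (w.ans₁ b) = Nat.testBit 1 b))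

/-- The index is a valid index for the original graph. -/
def isIdx : Bool := !(w.idxEq v S || w.idxEq v (S + 1))

/-- The index points to an edge of the clique. -/
def isClique : Bool :=
  bif decide (g = 3) then w.idxEq v 0 || (w.idxEq v 1 || w.idxEq v 2) else false

/-- The index points to the pendant edge of a clique vertex. -/
def isPendant : Bool := w.idxEq v g && (!w.isZero v && !w.isVertex v)

/-- A bit of the index. -/
def idxBit (b : ℕ) : Bool :=
  if hb : b < Nat.clog 2 (S + 2) then v (w.idx ⟨b, hb⟩) else false

/-- The lower bits of the neighbour; the wire `a` carries the bit of the original neighbour. -/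
def lowOut (a : W) (b : Fin n) : Bool :=
  bif v w.hi then
    bif w.isClique g v then
      Bool.xor (v (w.low b)) (bif w.idxEq v 0 then Nat.testBit 1 b else
        bif w.idxEq v 1 then Nat.testBit 2 b else Nat.testBit 3 b)
    else bif w.isPendant g v then v (w.low b) else false
  else bif w.isZero v then w.idxBit v b
  else bif w.isVertex v then (bif w.isIdx v then v a else false)
  else bif w.idxEq v 0 then v (w.low b) else false

/-- The top bit of the neighbour. -/
def hiOut : Bool :=
  bif v w.hi then w.isClique g v
  else bif w.isZero v then w.idxBit v n
  else bif w.isVertex v then false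
  else w.idxEq v 0

/-- The edge is a new one. -/
def isNew : Bool :=
  bif v w.hi then w.isClique g v || w.isPendant g v
  else w.idxEq v 0 && (!w.isZero v && !w.isVertex v)

/-- The bits of the sign; the wires `a`, `z` carry the bits of the original output and of the
input. -/
def signOut (a z : W) : Bool :=
  bif v w.hi then Bool.xor (v z) (w.isNew g v)
  else bif w.isVertex v && w.isIdx v then v a
  else Bool.xor (v z) (w.isNew g v)

/-! ### Gate counts of the output bits -/

section Size

variable {ι : Type} {R : ι → Type}

theorem bitSize_idxEq (hS : Nat.clog 2 (S + 2) ≤ n + 1) (k : ℕ) :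
    BitSize R (5 * n + 6) (fun v => w.idxEq v k) :=
  (BitSize.eqConst w.idx k).mono (by omega)

theorem bitSize_isZero : BitSize R (5 * n + 6) w.isZero :=
  (BitSize.eqConst w.low 0).mono (by omega)

theorem bitSize_isVertex : BitSize R (10 * n + 7) w.isVertex :=
  ((BitSize.eqConst w.ans₀ 0).and (BitSize.eqConst w.ans₁ 1)).not.mono (by omega)

theorem bitSize_isIdx (hS : Nat.clog 2 (S + 2) ≤ n + 1) : BitSize R (10 * n + 19) w.isIdx :=
  ((w.bitSize_idxEq hS S).or (w.bitSize_idxEq hS (S + 1))).not.mono (by omega)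

theorem bitSize_isClique (hS : Nat.clog 2 (S + 2) ≤ n + 1) :
    BitSize R (15 * n + 50) (w.isClique g) :=
  ((BitSize.const (decide (g = 3))).cond ((w.bitSize_idxEq hS 0).or
    ((w.bitSize_idxEq hS 1).or (w.bitSize_idxEq hS 2))) (.const false)).mono (by omega)

theorem bitSize_isPendant (hS : Nat.clog 2 (S + 2) ≤ n + 1) :
    BitSize R (20 * n + 50) (w.isPendant g) :=
  ((w.bitSize_idxEq hS g).and (w.bitSize_isZero.not.and w.bitSize_isVertex.not)).mono (by omega)

theorem bitSize_idxBit (b : ℕ) : BitSize R 1 (fun v => w.idxBit v b) := by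
  unfold idxBit
  split_ifs with hb
  · exact (BitSize.wire (w.idx ⟨b, hb⟩)).mono (by omega)
  · exact .const false

theorem bitSize_lowOut (hS : Nat.clog 2 (S + 2) ≤ n + 1) (a : W) (b : Fin n) :
    BitSize R (2000 * (n + 1)) (fun v => w.lowOut g v a b) := by
  have h₀ := w.bitSize_idxEq (R := R) hS 0
  have h₁ := w.bitSize_idxEq (R := R) hS 1
  exact ((BitSize.wire w.hi).cond
    ((w.bitSize_isClique g hS).cond
      ((BitSize.wire (w.low b)).xor
        (h₀.cond (.const (Nat.testBit 1 b)) (h₁.cond (.const (Nat.testBit 2 b)) (.const _))))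
      ((w.bitSize_isPendant g hS).cond (.wire (w.low b)) (.const false)))
    (w.bitSize_isZero.cond (w.bitSize_idxBit b)
      (w.bitSize_isVertex.cond ((w.bitSize_isIdx hS).cond (.wire a) (.const false))
        (h₀.cond (.wire (w.low b)) (.const false))))).mono (by omega)

theorem bitSize_hiOut (hS : Nat.clog 2 (S + 2) ≤ n + 1) :
    BitSize R (2000 * (n + 1)) (w.hiOut g) :=
  ((BitSize.wire w.hi).cond (w.bitSize_isClique g hS)
    (w.bitSize_isZero.cond (w.bitSize_idxBit n)
      (w.bitSize_isVertex.cond (.const false) (w.bitSize_idxEq hS 0)))).mono (by omega)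

theorem bitSize_isNew (hS : Nat.clog 2 (S + 2) ≤ n + 1) :
    BitSize R (100 * (n + 2)) (w.isNew g) :=
  ((BitSize.wire w.hi).cond ((w.bitSize_isClique g hS).or (w.bitSize_isPendant g hS))
    ((w.bitSize_idxEq hS 0).and (w.bitSize_isZero.not.and w.bitSize_isVertex.not))).mono
    (by omega)

theorem bitSize_signOut (hS : Nat.clog 2 (S + 2) ≤ n + 1) (a z : W) :
    BitSize R (2000 * (n + 1)) (fun v => w.signOut g v a z) := by
  have h := (BitSize.wire z).xor (w.bitSize_isNew (R := R) g hS)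
  exact ((BitSize.wire w.hi).cond h
    ((w.bitSize_isVertex.and (w.bitSize_isIdx hS)).cond (.wire a) h)).mono (by omega)

end Size

/-! ### Correctness of the output bits -/

section Correct

/-- The wires carry the bits of the vertex `i`, of the index `l` and of the answers of the
adjacency oracle. -/
structure Reads (adj : ℕ → ℕ → ℕ) (i l : ℕ) : Prop where
  hi : v w.hi = decide (2 ^ n ≤ i)
  low : ∀ b, v (w.low b) = (i % 2 ^ n).testBit b
  idx : ∀ b, v (w.idx b) = l.testBit b
  ans₀ : ∀ b, v (w.ans₀ b) = (adj (i % 2 ^ n) 0).testBit b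
  ans₁ : ∀ b, v (w.ans₁ b) = (adj (i % 2 ^ n) 1).testBit b

variable {w v g} {adj : ℕ → ℕ → ℕ} {V : Finset ℕ} {i l : ℕ}

theorem Reads.idxEq (h : w.Reads v adj i l) (hl : l < S + 2) {k : ℕ} (hk : k < S + 2) :
    w.idxEq v k = decide (l = k) := by
  have hS : S + 2 ≤ 2 ^ Nat.clog 2 (S + 2) := Nat.le_pow_clog (by norm_num) _
  rw [PadWires.idxEq, decide_eq_decide]
  simp only [h.idx]
  exact testBit_eq_iff (by omega) (by omega)

theorem Reads.isZero (h : w.Reads v adj i l) : w.isZero v = decide (i % 2 ^ n = 0) := by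
  rw [PadWires.isZero, decide_eq_decide]
  simp only [h.low]
  exact testBit_eq_iff (Nat.mod_lt _ (Nat.two_pow_pos n)) (Nat.two_pow_pos n)

/-- A vertex with a neighbour answers a nonzero label at index 0, and an isolated vertex answers the
padding value 0 at index 1. Both indices exist because `2 ≤ S`. -/
theorem mem_iff {G : SimpleGraph V} (hadj : IsAdjMap n S G adj) (hS : 2 ≤ S) {r : ℕ}
    (hr : r < 2 ^ n) : r ∈ V ↔ ¬ (adj r 0 = 0 ∧ adj r 1 = 1) := by
  constructor
  · rintro hrV ⟨h₀, h₁⟩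
    have hz : 0 ∉ V := fun h0 => by simpa using hadj.verts h0
    rcases Nat.eq_zero_or_pos (G.neighborSet ⟨r, hrV⟩).ncard with hd | hd
    · have := hadj.pad ⟨r, hrV⟩ 1 (by omega) (by omega)
      simp only at this
      omega
    · obtain ⟨w, _, hw⟩ := (hadj.neighbor ⟨r, hrV⟩).mapsTo hd
      simp only [h₀] at hw
      exact hz (hw ▸ w.2)
  · intro h
    by_contra hrV
    exact h ⟨hadj.marked r hr hrV 0 (by omega), hadj.marked r hr hrV 1 (by omega)⟩

theorem Reads.isVertex (h : w.Reads v adj i l) {G : SimpleGraph V} (hadj : IsAdjMap n S G adj)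
    (hS : 2 ≤ S) : w.isVertex v = decide (i % 2 ^ n ∈ V) := by
  have hr := Nat.mod_lt i (Nat.two_pow_pos n)
  have hn := hadj.le_two_pow (by omega)
  rw [PadWires.isVertex, ← Bool.decide_and, ← decide_not, decide_eq_decide, mem_iff hadj hS hr]
  simp only [h.ans₀, h.ans₁]
  rw [testBit_eq_iff (hadj.lt _ hr 0 (by omega)) (by omega),
    testBit_eq_iff (hadj.lt _ hr 1 (by omega)) (by omega)]

theorem Reads.isIdx (h : w.Reads v adj i l) (hl : l < S + 2) :
    w.isIdx v = decide (l < S) := by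
  rw [PadWires.isIdx, h.idxEq hl (by omega), h.idxEq hl (by omega), ← Bool.decide_or,
    ← decide_not, decide_eq_decide]
  omega

/-- The circuit tests `l` against 0, 1, 2 when `g = 3` and is constantly false otherwise, which
matches `l < g` only for the two admitted values of `g`. -/
theorem Reads.isClique (h : w.Reads v adj i l) (hl : l < S + 2) (hS : 2 ≤ S)
    (hg : g = 0 ∨ g = 3) : w.isClique g v = decide (l < g) := by
  rw [PadWires.isClique, h.idxEq hl (by omega), h.idxEq hl (by omega), h.idxEq hl (by omega)]
  rcases hg with rfl | rfl
  · simp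
  · rw [decide_eq_true rfl, cond_true, ← Bool.decide_or, ← Bool.decide_or, decide_eq_decide]
    omega

theorem Reads.isPendant (h : w.Reads v adj i l) (hl : l < S + 2) {G : SimpleGraph V}
    (hadj : IsAdjMap n S G adj) (hS : 2 ≤ S) (hg : g = 0 ∨ g = 3) :
    w.isPendant g v = decide (l = g ∧ i % 2 ^ n ≠ 0 ∧ i % 2 ^ n ∉ V) := by
  rw [PadWires.isPendant, h.idxEq hl (by omega), h.isZero, h.isVertex hadj hS]
  simp

theorem Reads.idxBit (h : w.Reads v adj i l) (hl : l < S + 2) (b : ℕ) :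
    w.idxBit v b = l.testBit b := by
  have hS : S + 2 ≤ 2 ^ Nat.clog 2 (S + 2) := Nat.le_pow_clog (by norm_num) _
  unfold PadWires.idxBit
  split_ifs with hb
  · exact h.idx _
  · have := Nat.pow_le_pow_right (show 0 < 2 by norm_num) (not_lt.1 hb)
    rw [Nat.testBit_lt_two_pow (by omega)]

theorem testBit_add_two_pow (x : ℕ) {b : ℕ} (hb : b < n) :
    (x + 2 ^ n).testBit b = x.testBit b := by
  rw [add_comm, Nat.testBit_two_pow_add_gt hb]

theorem Reads.lowOut (h : w.Reads v adj i l) (hi : i < 2 ^ (n + 1)) (hl : l < S + 2)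
    {G : SimpleGraph V} (hadj : IsAdjMap n S G adj) (hS : 2 ≤ S) (hg : g = 0 ∨ g = 3) {a : W}
    {b : Fin n} (ha : l < S → v a = (adj (i % 2 ^ n) l).testBit b) :
    w.lowOut g v a b = (padAdjMap n g S V adj i l).testBit b := by
  have h2 : 2 ^ (n + 1) = 2 * 2 ^ n := pow_succ' 2 n
  rw [PadWires.lowOut, h.hi, h.isClique hl hS hg, h.isPendant hl hadj hS hg, h.isZero,
    h.isVertex hadj hS, h.isIdx hl, h.idxEq hl (by omega), h.idxEq hl (by omega), h.low,
    h.idxBit hl]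
  by_cases hlt : i < 2 ^ n
  · simp only [padAdjMap, hlt, not_le.2 hlt, Nat.mod_eq_of_lt hlt] at ha ⊢
    by_cases hlS : l < S
    · simp only [hlS, ha hlS]
      simp only [decide_false, cond_false, if_true, Bool.cond_decide, apply_ite (Nat.testBit · b),
        Nat.zero_testBit, testBit_add_two_pow i b.2, decide_true, cond_true]
    · simp only [hlS]
      simp only [decide_false, cond_false, if_true, if_false, Bool.cond_decide,
        apply_ite (Nat.testBit · b), Nat.zero_testBit, testBit_add_two_pow i b.2]
  · obtain ⟨r, rfl⟩ : ∃ r, i = r + 2 ^ n := ⟨i - 2 ^ n, by omega⟩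
    have hr : r < 2 ^ n := by omega
    simp only [padAdjMap, hlt, not_lt.1 hlt, Nat.add_mod_right, Nat.mod_eq_of_lt hr,
      Nat.add_sub_cancel, decide_true, cond_true, if_false, Bool.cond_decide,
      apply_ite (Nat.testBit · b), Nat.zero_testBit, testBit_add_two_pow _ b.2, Nat.testBit_xor]
    by_cases hlg : l < g
    · have : l = 0 ∨ l = 1 ∨ l = 2 := by omega
      rcases this with rfl | rfl | rfl <;> simp [hlg]
    · simp only [hlg, if_false]

theorem Reads.hiOut (h : w.Reads v adj i l) (hi : i < 2 ^ (n + 1)) (hl : l < S + 2)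
    {G : SimpleGraph V} (hadj : IsAdjMap n S G adj) (hS : 2 ≤ S) (hg : g = 0 ∨ g = 3)
    (hgn : g < 2 ^ n) : w.hiOut g v = (padAdjMap n g S V adj i l).testBit n := by
  have h2 : 2 ^ (n + 1) = 2 * 2 ^ n := pow_succ' 2 n
  have htop {x : ℕ} (hx : x < 2 ^ n) : (x + 2 ^ n).testBit n = true := by
    rw [add_comm, Nat.testBit_two_pow_add_eq, Nat.testBit_lt_two_pow hx]; rfl
  rw [PadWires.hiOut, h.hi, h.isClique hl hS hg, h.isZero,
    h.isVertex hadj hS, h.idxEq hl (by omega), h.idxBit hl]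
  by_cases hlt : i < 2 ^ n
  · simp only [padAdjMap, hlt, not_le.2 hlt, Nat.mod_eq_of_lt hlt]
    by_cases hlS : l < S
    · simp only [hlS, decide_false, cond_false, if_true, Bool.cond_decide,
        apply_ite (Nat.testBit · n), Nat.zero_testBit, htop hlt,
        Nat.testBit_lt_two_pow (hadj.lt i hlt l hlS)]
      split_ifs <;> simp_all
    · simp only [hlS, decide_false, cond_false, if_true, if_false, Bool.cond_decide,
        apply_ite (Nat.testBit · n), Nat.zero_testBit, htop hlt]
      split_ifs <;> simp_all
  · obtain ⟨r, rfl⟩ : ∃ r, i = r + 2 ^ n := ⟨i - 2 ^ n, by omega⟩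
    have hr : r < 2 ^ n := by omega
    simp only [padAdjMap, hlt, not_lt.1 hlt, Nat.add_sub_cancel, decide_true, cond_true, if_false]
    by_cases hlg : l < g
    · simp only [hlg, if_true, decide_true]
      exact (htop (Nat.xor_lt_two_pow hr (by omega))).symm
    · simp only [hlg, if_false, decide_false, apply_ite (Nat.testBit · n), Nat.zero_testBit,
        Nat.testBit_lt_two_pow hr, ite_self]

/-- The code of `-1` has both bits set and that of 0 has none. So off the original edges the single
bit `isNew` is XORed into both bits of `z`. -/
theorem Reads.signOut (h : w.Reads v adj i l) (hi : i < 2 ^ (n + 1)) (hl : l < S + 2)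
    {G : SignedGraph V} (hadj : IsAdjMap n S G.graph adj) (hS : 2 ≤ S) (hg : g = 0 ∨ g = 3)
    {a z : W} {b : Fin 2}
    (ha : l < S → v a = Bool.xor (v z) (signBits (natSign G (i % 2 ^ n) (adj (i % 2 ^ n) l)) b)) :
    w.signOut g v a z = Bool.xor (v z) (signBits (padSignMap n g S G adj i l) b) := by
  have h2 : 2 ^ (n + 1) = 2 * 2 ^ n := pow_succ' 2 n
  have h0 : 0 ∉ V := fun h0 => by simpa using hadj.verts h0
  have hneg : signBits (-1) b = true := by fin_cases b <;> rfl
  have hzero : signBits 0 b = false := by fin_cases b <;> rfl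
  rw [PadWires.signOut, isNew, h.hi, h.isClique hl hS hg, h.isPendant hl hadj hS hg, h.isZero,
    h.isVertex hadj hS, h.isIdx hl, h.idxEq hl (by omega)]
  by_cases hlt : i < 2 ^ n
  · simp only [padSignMap, hlt, not_le.2 hlt, Nat.mod_eq_of_lt hlt] at ha ⊢
    by_cases hi0 : i = 0
    · simp [hi0, h0, hzero]
    · by_cases hiV : i ∈ V
      · by_cases hlS : l < S
        · simp [hi0, hiV, hlS, ha hlS]
        · simp [hi0, hiV, hlS, hzero]
      · by_cases hl0 : l = 0
        · simp [hi0, hiV, hl0, hneg]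
        · simp [hi0, hiV, hl0, hzero]
  · obtain ⟨r, rfl⟩ : ∃ r, i = r + 2 ^ n := ⟨i - 2 ^ n, by omega⟩
    have hr : r < 2 ^ n := by omega
    simp only [padSignMap, hlt, not_lt.1 hlt, Nat.add_mod_right, Nat.mod_eq_of_lt hr,
      Nat.add_sub_cancel, decide_true, cond_true, if_false]
    by_cases hlg : l < g
    · simp [hlg, hneg]
    · by_cases hc : l = g ∧ r ≠ 0 ∧ r ∉ V
      · simp only [hlg, if_pos hc, hneg, decide_eq_true hc, decide_false, Bool.false_or, if_false]
      · simp only [hlg, if_neg hc, hzero, decide_eq_false hc, decide_false, Bool.false_or, if_false]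

end Correct

end PadWires

open Circuit

/-! ### Assembling the two oracle circuits -/

section Circuits

variable {n S : ℕ}

/-- The wires carrying the lower bits of the vertex and of the index. -/
def lowReg (n S : ℕ) : AdjRegister n S → AdjRegister (n + 1) (S + 2) :=
  Sum.map Fin.castSucc (Fin.castLE (Nat.clog_mono_right 2 (Nat.le_add_right S 2)))

theorem adjState_comp_lowReg (i l : ℕ) :
    adjState (n + 1) (S + 2) i l ∘ lowReg n S = adjState n S (i % 2 ^ n) l := by
  funext k
  rcases k with k | k
  · simp [adjState, lowReg, Nat.testBit_mod_two_pow]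
  · simp [adjState, lowReg]

/-- Query the adjacency oracle for the indices `0` and `1` at the lower part of the vertex. -/
def probe (n S : ℕ) : Circuit (unsignedRegister n S) (AdjRegister (n + 1) (S + 2))
    (Fin n ⊕ Fin n) :=
  .const false <| .const true <|
  -- After the two constant gates `some none` carries false and `none` carries true: this call asks
  -- for index 0, and the next one sets only the lowest index bit.
  .call () (Sum.elim (fun b => some (some (Sum.inl b.castSucc))) fun _ => some none) <|
  .call () (Sum.elim (fun b => Sum.inl (some (some (Sum.inl b.castSucc))))
    fun b => Sum.inl (if b.val = 0 then none else some none)) <|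
  .output <| Sum.elim (fun b => Sum.inl (Sum.inr (Sum.inl b))) fun b => Sum.inr (Sum.inl b)

theorem eval_probe {adj : ℕ → ℕ → ℕ}
    {O : ∀ o, (unsignedRegister n S o → Bool) → (unsignedRegister n S o → Bool)}
    (hO : ImplementsAdj n S adj (O ())) (hS : 2 ≤ S) (i l : ℕ) :
    (probe n S).eval O (adjState (n + 1) (S + 2) i l) =
      Sum.elim (fun b : Fin n => (adj (i % 2 ^ n) 0).testBit b)
        (fun b : Fin n => (adj (i % 2 ^ n) 1).testBit b) := by
  have hr := Nat.mod_lt i (Nat.two_pow_pos n)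
  have h₀ : (fun k => (fun w : Option (Option (AdjRegister (n + 1) (S + 2))) => w.elim true
      (fun w => w.elim false (adjState (n + 1) (S + 2) i l)))
      (Sum.elim (fun b : Fin n => some (some (Sum.inl b.castSucc))) (fun _ => some none) k)) =
      adjState n S (i % 2 ^ n) 0 := by
    funext k
    rcases k with k | k <;> simp [adjState, Nat.testBit_mod_two_pow]
  have h₁ : (fun k => (fun w : Option (Option (AdjRegister (n + 1) (S + 2))) => w.elim true
      (fun w => w.elim false (adjState (n + 1) (S + 2) i l)))
      (Sum.elim (fun b : Fin n => some (some (Sum.inl b.castSucc)))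
        (fun b : Fin (Nat.clog 2 S) => if b.val = 0 then none else some none) k)) =
      adjState n S (i % 2 ^ n) 1 := by
    funext k
    rcases k with k | k
    · simp [adjState, Nat.testBit_mod_two_pow]
    · by_cases hk : k.val = 0
      · simp [adjState, hk]
      · have := mt Nat.testBit_one_eq_true_iff_self_eq_zero.1 hk
        simpa [adjState, hk] using this
  funext b
  rcases b with b | b
  · refine Eq.trans ?_ (congrFun (hO _ hr 0 (by omega)) (Sum.inl b))
    rw [← h₀]
    rfl
  · refine Eq.trans ?_ (congrFun (hO _ hr 1 (by omega)) (Sum.inl b))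
    rw [← h₁]
    simp only [probe, eval, Sum.elim_inr]
    congr 2
    funext k
    rcases k with k | k <;> rfl

/-- The wires of the padded graph after `probe`, for a given embedding of the input register. -/
def probedWires {W : Type} (f : AdjRegister (n + 1) (S + 2) → W) (p : Fin n ⊕ Fin n → W) :
    PadWires n S W where
  hi := f (Sum.inl (Fin.last n))
  low b := f (Sum.inl b.castSucc)
  idx b := f (Sum.inr b)
  ans₀ b := p (Sum.inl b)
  ans₁ b := p (Sum.inr b)

theorem probedWires_reads {W : Type} {f : AdjRegister (n + 1) (S + 2) → W}
    {p : Fin n ⊕ Fin n → W} {v : W → Bool} {adj : ℕ → ℕ → ℕ} {i l : ℕ} (hi : i < 2 ^ (n + 1))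
    (hf : v ∘ f = adjState (n + 1) (S + 2) i l)
    (hp : v ∘ p = Sum.elim (fun b : Fin n => (adj (i % 2 ^ n) 0).testBit b)
        (fun b : Fin n => (adj (i % 2 ^ n) 1).testBit b)) :
    (probedWires f p).Reads v adj i l := by
  have hf' (k) : v (f k) = adjState (n + 1) (S + 2) i l k := congrFun hf k
  have hp' (k) : v (p k) = _ := congrFun hp k
  refine ⟨?_, fun b => ?_, fun b => ?_, fun b => ?_, fun b => ?_⟩
  · simp only [probedWires, hf', adjState, Sum.elim_inl, Fin.val_last]
    rw [Nat.testBit_eq_decide_div_mod_eq, decide_eq_decide]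
    have h2 : 2 ^ (n + 1) = 2 * 2 ^ n := pow_succ' 2 n
    have hpos := Nat.two_pow_pos n
    have h₁ : i / 2 ^ n < 2 := by rw [Nat.div_lt_iff_lt_mul hpos]; omega
    rw [Nat.mod_eq_of_lt h₁]
    have h₃ := Nat.le_div_iff_mul_le (x := 1) (y := i) hpos
    omega
  · simp [probedWires, hf', adjState, Nat.testBit_mod_two_pow]
  · simp [probedWires, hf', adjState]
  · simp [probedWires, hp']
  · simp [probedWires, hp']

theorem clog_add_two_le (hS : 2 ≤ S) (hSn : S ≤ 2 ^ n) : Nat.clog 2 (S + 2) ≤ n + 1 := by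
  apply Nat.clog_le_of_le_pow
  rw [pow_succ]; omega

/-- A bound for the size of the circuits of the padded graph. -/
def padBound (n : ℕ) : ℕ := 20000 * (n + 1) ^ 2

/-- The third call uses the truncated vertex and index, and its answer matters only if `l < S`. The
slack 3 in the size absorbs the extra gate that `size_subst_le` charges per call when the circuit is
moved to the signed oracles by `callAdj`. -/
theorem exists_adjCircuit (g : ℕ) (hg : g = 0 ∨ g = 3) (hgn : g < 2 ^ n) (hS : 2 ≤ S)
    (hSn : S ≤ 2 ^ n) :
    ∃ C : Circuit (unsignedRegister n S) (AdjRegister (n + 1) (S + 2))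
      (AdjRegister (n + 1) (S + 2)), C.calls ≤ 3 ∧ C.size + 3 ≤ padBound n ∧
      ∀ (V : Finset ℕ) (G : SimpleGraph V) (adj : ℕ → ℕ → ℕ)
        (O : ∀ o, (unsignedRegister n S o → Bool) → (unsignedRegister n S o → Bool)),
        IsAdjMap n S G adj → ImplementsAdj n S adj (O ()) →
        ImplementsAdj (n + 1) (S + 2) (padAdjMap n g S V adj) (C.eval O) := by
  have hclog := clog_add_two_le hS hSn
  let W := (AdjRegister (n + 1) (S + 2) ⊕ (Fin n ⊕ Fin n)) ⊕ AdjRegister n S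
  let w : PadWires n S W := probedWires (Sum.inl ∘ Sum.inl) (Sum.inl ∘ Sum.inr)
  let f : AdjRegister (n + 1) (S + 2) → (W → Bool) → Bool := Sum.elim
    (fun b => Fin.lastCases (w.hiOut g) (fun b v => w.lowOut g v (Sum.inr (Sum.inl b)) b) b)
    (fun b v => v (w.idx b))
  have hf (k) : BitSize (unsignedRegister n S) (2000 * (n + 1)) (f k) := by
    rcases k with b | b
    · induction b using Fin.lastCases with
      | last => simpa [f] using w.bitSize_hiOut g hclog
      | cast b => simpa [f] using w.bitSize_lowOut g hclog _ b
    · exact (BitSize.wire _).mono (Nat.zero_le _)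
  obtain ⟨K, hK₁, hK₂, hK₃⟩ := BitSize.exists_circuit hf
  refine ⟨(probe n S).andThen (.call () (Sum.inl ∘ lowReg n S) K) id, ?_, ?_, ?_⟩
  · simp [calls_andThen, calls, probe, hK₁]
  · simp only [size_andThen, size, probe, padBound]
    simp only [Fintype.card_sum, Fintype.card_fin] at hK₂
    -- At most `2 * (n + 1)` output bits of `2000 * (n + 1)` gates each: this makes `padBound`
    -- quadratic.
    have : (n + 1 + Nat.clog 2 (S + 2)) * (2000 * (n + 1)) ≤
        (n + 1 + (n + 1)) * (2000 * (n + 1)) := by gcongr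
    nlinarith
  · intro V G adj O hadj hO i hi l hl
    rw [eval_andThen, eval_probe hO hS]
    simp only [eval, Function.comp_id]
    funext k
    rw [hK₃]
    set v : W → Bool := _
    change f k v = _
    have hin : v ∘ (Sum.inl ∘ Sum.inl) = adjState (n + 1) (S + 2) i l := rfl
    have hread : w.Reads v adj i l := probedWires_reads hi hin rfl
    have hans (hlS : l < S) : v ∘ Sum.inr = adjState n S (adj (i % 2 ^ n) l) l := by
      rw [← hO _ (Nat.mod_lt i (Nat.two_pow_pos n)) l hlS, ← adjState_comp_lowReg]
      rfl
    rcases k with b | b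
    · induction b using Fin.lastCases with
      | last =>
        simp only [f, Sum.elim_inl, Fin.lastCases_last]
        exact hread.hiOut hi hl hadj hS hg hgn
      | cast b =>
        simp only [f, Sum.elim_inl, Fin.lastCases_castSucc]
        exact hread.lowOut hi hl hadj hS hg fun hlS => congrFun (hans hlS) (Sum.inl b)
    · exact hread.idx b

/-- A single call of the adjacency oracle of a signed graph. -/
def callAdj (n S : ℕ) (o : Unit) :
    Circuit (signedRegister n S) (unsignedRegister n S o) (unsignedRegister n S o) :=
  .call .adj id (.output Sum.inr)

theorem exists_signCircuit (g : ℕ) (hg : g = 0 ∨ g = 3) (hgn : g < 2 ^ n) (hS : 2 ≤ S)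
    (hSn : S ≤ 2 ^ n) :
    ∃ C : Circuit (signedRegister n S) (SignRegister (n + 1) (S + 2))
      (SignRegister (n + 1) (S + 2)), C.calls ≤ 3 ∧ C.size ≤ padBound n ∧
      ∀ (V : Finset ℕ) (G : SignedGraph V) (adj : ℕ → ℕ → ℕ)
        (O : ∀ o, (signedRegister n S o → Bool) → (signedRegister n S o → Bool)),
        IsAdjMap n S G.graph adj → ImplementsAdj n S adj (O .adj) →
        ImplementsSign n S G adj (O .sign) →
        ImplementsSign (n + 1) (S + 2) (padSigned n g G) (padAdjMap n g S V adj) (C.eval O) := by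
  have hclog := clog_add_two_le hS hSn
  let W := (SignRegister (n + 1) (S + 2) ⊕ (Fin n ⊕ Fin n)) ⊕ SignRegister n S
  let w : PadWires n S W := probedWires (Sum.inl ∘ Sum.inl ∘ Sum.inl) (Sum.inl ∘ Sum.inr)
  let f : SignRegister (n + 1) (S + 2) → (W → Bool) → Bool := Sum.elim
    (fun k v => v (Sum.inl (Sum.inl (Sum.inl k))))
    (fun b v => w.signOut g v (Sum.inr (Sum.inr b)) (Sum.inl (Sum.inl (Sum.inr b))))
  have hf (k) : BitSize (signedRegister n S) (2000 * (n + 1)) (f k) := by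
    rcases k with b | b
    · exact (BitSize.wire _).mono (Nat.zero_le _)
    · exact w.bitSize_signOut g hclog _ _
  obtain ⟨K, hK₁, hK₂, hK₃⟩ := BitSize.exists_circuit hf
  have hcalls := calls_subst_le (callAdj n S) (k := 1) (fun _ => le_rfl) (probe n S)
  have hsize := size_subst_le (callAdj n S) (s := 1) (fun _ => le_rfl) (probe n S)
  refine ⟨(((probe n S).subst (callAdj n S)).rename Sum.inl).andThen
    (.call .sign (Sum.inl ∘ Sum.map (lowReg n S) id) K) id, ?_, ?_, ?_⟩
  · simp only [calls_andThen, calls, probe, hK₁, calls_rename] at hcalls ⊢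
    omega
  · simp only [size_andThen, size, calls, probe, padBound, size_rename] at hsize ⊢
    simp only [Fintype.card_sum, Fintype.card_fin] at hK₂
    have : (n + 1 + Nat.clog 2 (S + 2) + 2) * (2000 * (n + 1)) ≤
        (n + 1 + (n + 1) + 2) * (2000 * (n + 1)) := by gcongr
    nlinarith
  · intro V G adj O hadj hO hsign i hi l hl z
    rw [eval_andThen, eval_rename, eval_subst]
    have h₀ : signState (n + 1) (S + 2) i l z ∘ Sum.inl = adjState (n + 1) (S + 2) i l := rfl
    rw [h₀, eval_probe (adj := adj) hO hS, natSign_padAdjMap hadj hS hgn (by omega) hi hl]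
    simp only [eval, Function.comp_id]
    funext k
    rw [hK₃]
    set v : W → Bool := _
    change f k v = _
    have hread : w.Reads v adj i l := probedWires_reads hi rfl rfl
    have hr := Nat.mod_lt i (Nat.two_pow_pos n)
    have hans (hlS : l < S) := hsign _ hr l hlS z
    have harg : signState (n + 1) (S + 2) i l z ∘ Sum.map (lowReg n S) id =
        signState n S (i % 2 ^ n) l z := by
      funext k
      rcases k with k | k
      · exact congrFun (adjState_comp_lowReg i l) k
      · rfl
    rw [← harg] at hans
    rcases k with b | b
    · rfl
    · exact hread.signOut hi hl hadj hS hg fun hlS => congrFun (hans hlS) (Sum.inr b)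

end Circuits

/-! ### Choice of the clique size and reduction of the unsigned case -/

section Main

variable {n S : ℕ}

/-- The size parameter of the cliques of the padded graph. -/
def cliqueParam (n : ℕ) : ℕ := if n = 1 then 0 else 3

theorem cliqueParam_eq (n : ℕ) : cliqueParam n = 0 ∨ cliqueParam n = 3 := by
  unfold cliqueParam; split_ifs <;> simp

theorem cliqueParam_lt (hS : 2 ≤ S) (hSn : S ≤ 2 ^ n) : cliqueParam n < 2 ^ n := by
  unfold cliqueParam
  split_ifs with h
  · exact Nat.two_pow_pos n
  · have : n ≠ 0 := by rintro rfl; simp at hSn; omega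
    have : 2 ^ 2 ≤ 2 ^ n := Nat.pow_le_pow_right (by norm_num) (by omega)
    omega

/-- For `n = 1` the only possible vertex is 1, so `G` has no edges and is balanced; `n = 0` would
leave no vertex at all. -/
theorem cliqueParam_spec {V : Finset ℕ} (hV : V ⊆ Finset.Ico 1 (2 ^ n)) (hne : V.Nonempty)
    (G : SignedGraph V) : (cliqueParam n = 3 ∧ 2 ≤ n) ∨ G.HasBalancedComponent := by
  obtain ⟨x, hx⟩ := hne
  have hx' := Finset.mem_Ico.1 (hV hx)
  have hn : n ≠ 0 := by rintro rfl; omega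
  by_cases h : n = 1
  · subst h
    right
    have hone (u : V) : (u : ℕ) = 1 := by
      have := Finset.mem_Ico.1 (hV u.2); omega
    rw [SignedGraph.hasBalancedComponent_iff]
    refine ⟨⟨x, hx⟩, fun _ => false, fun u w _ huw => ?_⟩
    exact absurd (Subtype.ext ((hone u).trans (hone w).symm)) huw.ne
  · left
    exact ⟨if_neg h, by omega⟩

theorem padSigned_negative (g : ℕ) {V : Finset ℕ} (G : SimpleGraph V) :
    padSigned n g (negative G) = negative (padGraph n g G) := by
  have hf : (fun u v : Finset.Icc 1 (2 ^ (n + 1) - 1) =>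
      if natSign (negative G) u v = 1 then (1 : ℤˣ) else -1) = fun _ _ => -1 := by
    funext u v
    rw [if_neg]
    intro h
    obtain ⟨hu, hv, hadj⟩ := mem_of_natSign_ne_zero (G := negative G) (i := u) (j := v) (by omega)
    have hs : (negative G).sgn ⟨u, hu⟩ ⟨v, hv⟩ = -1 := SignedGraph.sgn_ofSymm (G := G) hadj
    rw [natSign, dif_pos ⟨hu, hv⟩, hs] at h
    omega
  unfold padSigned negative
  congr 1

theorem two_pow_pred_bounds (hS : 2 ≤ S) (hSn : S ≤ 2 ^ n) :
    1 ≤ 2 ^ (n + 1) - 1 ∧ 2 ^ (n + 1) - 1 ≤ 2 ^ (n + 1) := by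
  have h2 : 2 ^ (n + 1) = 2 * 2 ^ n := pow_succ' 2 n
  omega

theorem eval_padPolynomial (n : ℕ) :
    (Polynomial.C 20000 * (Polynomial.X + 1) ^ 2 : Polynomial ℕ).eval n = padBound n := by
  simp [padBound]

/-- Substituting circuits for the oracles. -/
theorem exists_boolCircuit {ι : Type} {R : ι → Type} {W out : Type} (C : Circuit R W out)
    (O : ∀ o, (R o → Bool) → (R o → Bool)) (D : ∀ o, BoolCircuit (R o) (R o))
    (hD : ∀ o, (D o).compute = O o) {c q s : ℕ} (hc : C.calls ≤ c) (hq : C.size ≤ q)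
    (hs : ∀ o, (D o).size ≤ s) :
    ∃ D' : BoolCircuit W out, D'.compute = C.eval O ∧ D'.size ≤ q + c * s := by
  refine ⟨C.subst D, ?_, (size_subst_le D hs C).trans (by gcongr)⟩
  funext v
  have hO : (fun o => (D o).eval fun e : Empty => e.elim) = O := funext hD
  exact (eval_subst D _ C v).trans (by rw [hO])

end Main

end SparseAccess

theorem mainTheorem6 :
    -- signed graphs
    (∃ (c : ℕ) (q : Polynomial ℕ), ∀ n S : ℕ, 2 ≤ S →
      ∃ C : ∀ o, SparseAccess.Circuit (SparseAccess.signedRegister n S)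
          (SparseAccess.signedRegister (n + 1) (S + 2) o)
          (SparseAccess.signedRegister (n + 1) (S + 2) o),
        (∀ o, (C o).calls ≤ c ∧ (C o).size ≤ q.eval n) ∧
        ∀ (V : Finset ℕ) (_ : V.Nonempty) (G : SparseAccess.SignedGraph V)
          (O : ∀ o, (SparseAccess.signedRegister n S o → Bool) →
            (SparseAccess.signedRegister n S o → Bool)),
          SparseAccess.IsSignedSparseAccess n S G O →
          ∃ N' : ℕ, 1 ≤ N' ∧ N' ≤ 2 ^ (n + 1) ∧
          ∃ G' : SparseAccess.SignedGraph (Finset.Icc 1 N'),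
            (∀ v, (G'.graph.neighborSet v).ncard ≤ S + 2) ∧
            (G.HasBalancedComponent ↔ G'.HasBalancedComponent) ∧
            SparseAccess.IsSignedSparseAccess (n + 1) (S + 2) G' (fun o => (C o).eval O) ∧
            -- if the original oracles are given by circuits, so are the new ones
            ∀ D : ∀ o, SparseAccess.BoolCircuit (SparseAccess.signedRegister n S o)
                (SparseAccess.signedRegister n S o),
              (∀ o, (D o).compute = O o) →
              ∃ D' : ∀ o, SparseAccess.BoolCircuit
                  (SparseAccess.signedRegister (n + 1) (S + 2) o)
                  (SparseAccess.signedRegister (n + 1) (S + 2) o),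
                ∀ o, (D' o).compute = (C o).eval O ∧
                  (D' o).size ≤ q.eval n + c * ((D .adj).size + (D .sign).size)) ∧
    -- unsigned graphs
    (∃ (c : ℕ) (q : Polynomial ℕ), ∀ n S : ℕ, 2 ≤ S →
      ∃ C : ∀ o, SparseAccess.Circuit (SparseAccess.unsignedRegister n S)
          (SparseAccess.unsignedRegister (n + 1) (S + 2) o)
          (SparseAccess.unsignedRegister (n + 1) (S + 2) o),
        (∀ o, (C o).calls ≤ c ∧ (C o).size ≤ q.eval n) ∧
        ∀ (V : Finset ℕ) (_ : V.Nonempty) (G : SimpleGraph V)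
          (O : ∀ o, (SparseAccess.unsignedRegister n S o → Bool) →
            (SparseAccess.unsignedRegister n S o → Bool)),
          SparseAccess.IsSparseAccess n S G O →
          ∃ N' : ℕ, 1 ≤ N' ∧ N' ≤ 2 ^ (n + 1) ∧
          ∃ G' : SimpleGraph (Finset.Icc 1 N'),
            (∀ v, (G'.neighborSet v).ncard ≤ S + 2) ∧
            (SparseAccess.HasBipartiteComponent G ↔ SparseAccess.HasBipartiteComponent G') ∧
            SparseAccess.IsSparseAccess (n + 1) (S + 2) G' (fun o => (C o).eval O) ∧
            ∀ D : ∀ o, SparseAccess.BoolCircuit (SparseAccess.unsignedRegister n S o)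
                (SparseAccess.unsignedRegister n S o),
              (∀ o, (D o).compute = O o) →
              ∃ D' : ∀ o, SparseAccess.BoolCircuit
                  (SparseAccess.unsignedRegister (n + 1) (S + 2) o)
                  (SparseAccess.unsignedRegister (n + 1) (S + 2) o),
                ∀ o, (D' o).compute = (C o).eval O ∧
                  (D' o).size ≤ q.eval n + c * (D ()).size) := by
  refine ⟨⟨3, .C 20000 * (.X + 1) ^ 2, fun n S hS => ?_⟩,
    ⟨3, .C 20000 * (.X + 1) ^ 2, fun n S hS => ?_⟩⟩
  · rw [SparseAccess.eval_padPolynomial]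
    by_cases hSn : S ≤ 2 ^ n
    swap
    -- For `S > 2 ^ n` no marked access exists, by `IsAdjMap.le_two_pow`, so any circuit will do.
    · refine ⟨fun _ => .output id, fun _ => ⟨Nat.zero_le _, Nat.zero_le _⟩, ?_⟩
      rintro V _ G O ⟨adj, hadj, _⟩
      exact absurd (hadj.le_two_pow (by omega)) hSn
    obtain ⟨A, hA₁, hA₂, hA₃⟩ :=
      SparseAccess.exists_adjCircuit _ (SparseAccess.cliqueParam_eq n) (SparseAccess.cliqueParam_lt hS hSn) hS hSn
    obtain ⟨B, hB₁, hB₂, hB₃⟩ :=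
      SparseAccess.exists_signCircuit _ (SparseAccess.cliqueParam_eq n) (SparseAccess.cliqueParam_lt hS hSn) hS hSn
    have hA₁' := SparseAccess.Circuit.calls_subst_le (SparseAccess.callAdj n S) (k := 1) (fun _ => le_rfl) A
    have hA₂' := SparseAccess.Circuit.size_subst_le (SparseAccess.callAdj n S) (s := 1) (fun _ => le_rfl) A
    have hcost : ∀ o, (SparseAccess.OracleName.rec (A.subst (SparseAccess.callAdj n S)) B o : SparseAccess.Circuit (SparseAccess.signedRegister n S)
        (SparseAccess.signedRegister (n + 1) (S + 2) o) (SparseAccess.signedRegister (n + 1) (S + 2) o)).calls ≤ 3 ∧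
        (SparseAccess.OracleName.rec (A.subst (SparseAccess.callAdj n S)) B o : SparseAccess.Circuit (SparseAccess.signedRegister n S)
        (SparseAccess.signedRegister (n + 1) (S + 2) o) (SparseAccess.signedRegister (n + 1) (S + 2) o)).size ≤
          SparseAccess.padBound n := by
      rintro (_ | _)
      · exact ⟨hA₁'.trans (by omega), hA₂'.trans (by omega)⟩
      · exact ⟨hB₁, hB₂⟩
    refine ⟨_, hcost, ?_⟩
    rintro V hV G O ⟨adj, hadj, hO, hsign⟩
    have hpad := SparseAccess.isAdjMap_pad hadj hS (SparseAccess.cliqueParam_lt hS hSn)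
      (by rcases SparseAccess.cliqueParam_eq n with h | h <;> omega)
    obtain ⟨hN₁, hN₂⟩ := SparseAccess.two_pow_pred_bounds hS hSn
    refine ⟨2 ^ (n + 1) - 1, hN₁, hN₂, SparseAccess.padSigned n (SparseAccess.cliqueParam n) G, hpad.degree_le,
      SparseAccess.padSigned_hasBalancedComponent_iff hadj.verts G (SparseAccess.cliqueParam_spec hadj.verts hV G),
      ⟨_, hpad, ?_, hB₃ V G adj O hadj hO hsign⟩, fun D hD => ?_⟩
    · intro i hi l hl
      exact (SparseAccess.Circuit.eval_subst _ _ A _).trans (hA₃ V G.graph adj (fun _ => O .adj) hadj hO i hi l hl)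
    · have h (o) := SparseAccess.exists_boolCircuit _ O D hD (hcost o).1 (hcost o).2
        (s := (D .adj).size + (D .sign).size) (by rintro (_ | _) <;> omega)
      choose D' hD' using h
      exact ⟨D', hD'⟩
  · rw [SparseAccess.eval_padPolynomial]
    by_cases hSn : S ≤ 2 ^ n
    swap
    · refine ⟨fun _ => .output id, fun _ => ⟨Nat.zero_le _, Nat.zero_le _⟩, ?_⟩
      rintro V _ G O ⟨adj, hadj, _⟩
      exact absurd (hadj.le_two_pow (by omega)) hSn
    obtain ⟨A, hA₁, hA₂, hA₃⟩ :=
      SparseAccess.exists_adjCircuit _ (SparseAccess.cliqueParam_eq n) (SparseAccess.cliqueParam_lt hS hSn) hS hSn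
    have hA₂' : A.size ≤ SparseAccess.padBound n := by omega
    refine ⟨fun _ => A, fun _ => ⟨hA₁, hA₂'⟩, ?_⟩
    rintro V hV G O ⟨adj, hadj, hO⟩
    have hpad := SparseAccess.isAdjMap_pad hadj hS (SparseAccess.cliqueParam_lt hS hSn)
      (by rcases SparseAccess.cliqueParam_eq n with h | h <;> omega)
    obtain ⟨hN₁, hN₂⟩ := SparseAccess.two_pow_pred_bounds hS hSn
    refine ⟨2 ^ (n + 1) - 1, hN₁, hN₂, SparseAccess.padGraph n (SparseAccess.cliqueParam n) G, hpad.degree_le, ?_,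
      ⟨_, hpad, hA₃ V G adj O hadj hO⟩, fun D hD => ?_⟩
    -- Padding the all-negative graph yields the all-negative padded graph, so the signed
    -- equivalence applies.
    · rw [← SparseAccess.hasBalancedComponent_negative_iff, ← SparseAccess.hasBalancedComponent_negative_iff,
        ← SparseAccess.padSigned_negative]
      exact SparseAccess.padSigned_hasBalancedComponent_iff hadj.verts _
        (SparseAccess.cliqueParam_spec hadj.verts hV _)
    · obtain ⟨D', hD'⟩ := SparseAccess.exists_boolCircuit A O D hD hA₁ hA₂' (s := (D ()).size)
        (fun _ => le_rfl)
      exact ⟨fun _ => D', fun _ => hD'⟩
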